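/- Let $\mathbb{K}$ be an algebraically closed field of characteristic $0$, and let $p\in\mathbb{K}[x,y]\setminus(\mathbb{K}[x]\cup\mathbb{K}[y])$ be irreducible. Let $\mathbb{K}[x,y]_p$ be the ring of rational functions in $\mathbb{K}(x,y)$ whose (reduced) denominator is not divisible by $p$, and let $\langle p\rangle$ be the ideal generated by $p$ therein. Let $r\in\mathbb{K}[x,y]_p$, and let $(f,g)\in\mathbb{K}(x)\times\mathbb{K}(y)$ be such that $f-g\in r+\langle p\rangle$. Let $C\subseteq\mathbb{P}^1(\mathbb{K})\times\mathbb{P}^1(\mathbb{K})$ be the curve defined by the bi-homogenization $x_0^{\deg_x p}y_0^{\deg_y p}\,p(x_1/x_0,y_1/y_0)$ of $p$. The orbit of a point of $C$ is its equivalence class under the smallest equivalence relation $\sim$ on $C$ such that $(a,b)\sim(c,d)$ whenever $a=c$ or $b=d$. If $(\infty,\infty)\in C$, it is called a pole of $r$ if there is a Puiseux series $\varphi$ over $\mathbb{K}$ in $x^{-1}$ such that $p(x,\varphi)=0$, $\deg\varphi>0$ and $\deg r(x,\varphi)>0$. A point $(s_1,s_2)\in C$ is called a pole of $r$ if there is a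 transformation $T:(x,y)\mapsto\left(\frac{a_1x+b_1}{c_1x+d_1},\frac{a_2y+b_2}{c_2y+d_2}\right)$ of $\mathbb{P}^1(\mathbb{K})\times\mathbb{P}^1(\mathbb{K})$ (with $a_i,b_i,c_i,d_i\in\mathbb{K}$, $a_id_i-b_ic_i\neq0$) that maps $(s_1,s_2)$ to $(\infty,\infty)$ and such that $(\infty,\infty)$ is, in the sense above, a pole of $r\circ T^{-1}$ on the curve associated with the numerator of $p\circ T^{-1}$. If the orbit of a pole of $r$ is infinite, then there is a pole $(t_1,t_2)$ of $r$ in this orbit such that $t_1$ is not a pole of $f$ or $t_2$ is not a pole of $g$. -/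

import Mathlib

open Polynomial
open scoped Polynomial.Bivariate OnePoint

noncomputable section

namespace SepVar

/-- The field `K(x, y)`: the field of fractions of `K[x, y]`. In `K[X][Y]` the variable `x` is `C X`
(the inner one) and `y` is `Y` (the outer one). -/
abbrev RatFunc₂ (K : Type*) [Field K] : Type _ := FractionRing K[X][Y]

variable {K : Type*} [Field K]

/-- The numerator `r_n` of a rational function in reduced form. -/
abbrev numer (r : RatFunc₂ K) : K[X][Y] := IsFractionRing.num K[X][Y] r

/-- The denominator `r_d` of a rational function in reduced form. -/
abbrev denom (r : RatFunc₂ K) : K[X][Y] := (IsFractionRing.den K[X][Y] r : K[X][Y])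

/-- The inclusion `K[x, y] ⊆ K(x, y)`. -/
abbrev ofPoly (p : K[X][Y]) : RatFunc₂ K := algebraMap K[X][Y] (RatFunc₂ K) p

/-- The variable `x` as an element of `K(x, y)`. -/
def varX : RatFunc₂ K := ofPoly (C X)

/-- The variable `y` as an element of `K(x, y)`. -/
def varY : RatFunc₂ K := ofPoly Y

/-- The value `r(u, v)` of `r ∈ K(x, y)` at elements `u, v` of a field extension of `K`, meaningful
when the denominator of `r` does not vanish at `(u, v)`. -/
def evalRat {L : Type*} [Field L] [Algebra K L] (u v : L) (r : RatFunc₂ K) : L :=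
  aevalAeval u v (numer r) / aevalAeval u v (denom r)

/-! ### Separated multiples modulo `p` -/

/-- The local ring `K[x, y]_p`: the rational functions whose denominator is not divisible by `p`. -/
def localRing (p : K[X][Y]) : Set (RatFunc₂ K) := {r | ¬ p ∣ denom r}

/-- The ideal `⟨p⟩` that `p` generates in `K[x, y]_p`. -/
def localIdeal (p : K[X][Y]) : Set (RatFunc₂ K) := {s | ∃ q ∈ localRing p, s = q * ofPoly p}

/-- The set `F(r, p)` of all `(f, g) ∈ K(x) × K(y)` such that `f - g ∈ r + ⟨p⟩`. -/
def sepSet (r : RatFunc₂ K) (p : K[X][Y]) : Set (RatFunc K × RatFunc K) :=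
  {fg | ∃ s ∈ localIdeal p,
    fg.1.eval (algebraMap K (RatFunc₂ K)) varX - fg.2.eval (algebraMap K (RatFunc₂ K)) varY = r + s}

/-- `s ∈ K ∪ {∞}` is a pole of the univariate rational function `f`: a root of its reduced
denominator if `s` is finite; if `s = ∞`, the degree of the numerator exceeds the degree of the
denominator. -/
def IsPoleUniv (f : RatFunc K) : OnePoint K → Prop
  | ∞ => f.denom.natDegree < f.num.natDegree
  | (a : K) => f.denom.IsRoot a

/-! ### The curve in `ℙ¹(K) × ℙ¹(K)` and its orbits -/

/-- The degree of `p` in `x`. (The degree in `y` is `p.natDegree`.) -/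
def degX (p : K[X][Y]) : ℕ := p.support.sup fun j => (p.coeff j).natDegree

/-- The value at `((x₀ : x₁), (y₀ : y₁))` of the bi-homogenization
`x₀ ^ deg_x p * y₀ ^ deg_y p * p (x₁ / x₀, y₁ / y₀)`. -/
def biHom (p : K[X][Y]) (x₀ x₁ y₀ y₁ : K) : K :=
  ∑ j ∈ Finset.range (p.natDegree + 1), ∑ i ∈ Finset.range (degX p + 1),
    (p.coeff j).coeff i * (x₀ ^ (degX p - i) * x₁ ^ i) * (y₀ ^ (p.natDegree - j) * y₁ ^ j)

/-- The homogeneous coordinate `x₀` of a point of `ℙ¹(K) = K ∪ {∞}`: `a = (1 : a)`,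
`∞ = (0 : 1)`. -/
def coord₀ : OnePoint K → K
  | ∞ => 0
  | (_ : K) => 1

/-- The homogeneous coordinate `x₁` of a point of `ℙ¹(K) = K ∪ {∞}`: `a = (1 : a)`,
`∞ = (0 : 1)`. -/
def coord₁ : OnePoint K → K
  | ∞ => 1
  | (a : K) => a

/-- The curve in `ℙ¹(K) × ℙ¹(K)` associated with the bi-homogenization of `p`. -/
def curve (p : K[X][Y]) : Set (OnePoint K × OnePoint K) :=
  {s | biHom p (coord₀ s.1) (coord₁ s.1) (coord₀ s.2) (coord₁ s.2) = 0}

/-- The orbit of a point of the curve: its class for the smallest equivalence relation on the curve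
for which points sharing their first or their second coordinate are equivalent. -/
def orbit (p : K[X][Y]) (s : curve p) : Set (curve p) :=
  {t | Relation.EqvGen (fun a b : curve p => a.1.1 = b.1.1 ∨ a.1.2 = b.1.2) s t}

/-! ### Poles on the curve, through Puiseux series -/

/-- A Hahn series with rational exponents is a Puiseux series if its exponents have a common
denominator. -/
def IsPuiseux (φ : HahnSeries ℚ K) : Prop :=
  ∃ n : ℕ, 0 < n ∧ ∀ α ∈ φ.support, ∃ k : ℤ, α = k / n

/-- For a series in the variable `x⁻¹`: its degree in `x`, that is, minus its order in `x⁻¹`,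
is positive (the degree of `0` being `-∞`). -/
def PosDegree (φ : HahnSeries ℚ K) : Prop := φ.orderTop < 0

/-- The element `x` of the field of series in `x⁻¹`. -/
def serX : HahnSeries ℚ K := HahnSeries.single (-1) 1

/-- `(∞, ∞)` is a pole of `r` on the curve of `p`: there is a Puiseux series `φ` in `x⁻¹` with
`p(x, φ) = 0`, `deg φ > 0` and `deg r(x, φ) > 0`. -/
def IsPoleAtInfty (p : K[X][Y]) (r : RatFunc₂ K) : Prop :=
  ∃ φ : HahnSeries ℚ K, IsPuiseux φ ∧ aevalAeval serX φ p = 0 ∧ PosDegree φ ∧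
    PosDegree (evalRat serX φ r)

/-- The Möbius transform `(a u + b) / (c u + d)` of an element `u` of a field extension of `K`. -/
def moebius {L : Type*} [Field L] [Algebra K L] (A : GL (Fin 2) K) (u : L) : L :=
  (algebraMap K L (A 0 0) * u + algebraMap K L (A 0 1)) /
    (algebraMap K L (A 1 0) * u + algebraMap K L (A 1 1))

/-- The rational function `r ∘ T` for the transformation `T : (x, y) ↦ (A x, B y)`. -/
def compT (r : RatFunc₂ K) (A B : GL (Fin 2) K) : RatFunc₂ K :=
  evalRat (moebius A varX) (moebius B varY) r

open Classical in
/-- The point `s` of the curve of `p` is a pole of `r`: some transformation `T = (A, B)` of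
`ℙ¹(K) × ℙ¹(K)` maps `s` to `(∞, ∞)`, and the latter is a pole of `r ∘ T⁻¹` on the curve of the
numerator of `p ∘ T⁻¹`. -/
def IsPole (p : K[X][Y]) (r : RatFunc₂ K) (s : curve p) : Prop :=
  ∃ A B : GL (Fin 2) K, A • s.1.1 = ∞ ∧ B • s.1.2 = ∞ ∧
    IsPoleAtInfty (numer (compT (ofPoly p) A⁻¹ B⁻¹)) (compT r A⁻¹ B⁻¹)

end SepVar

end

noncomputable section

namespace SepVar

/-! ### Hensel's lemma for factorizations over `K⟦X⟧` -/

section Hensel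

variable {K : Type*} [Field K]

/-! Suppose that at every pole $t$ of $r$ in the orbit, $f$ has a pole at $t_1$ and $g$ has one at
$t_2$. Through any point $t$ of the orbit passes a branch of the curve, given by a Puiseux series
(`exists_branch`), and along it $f-g\in r+\langle p\rangle$ becomes the equation $f(u)-g(v)=r(u,v)$
(`ratEval_sub_ratEval`). If $r$ is infinite along the branch, then $t$ is a pole of $r$
(`isPole_of_branch`), so both $f$ and $g$ have poles there by assumption; if $r$ stays finite, then
$f(u)$ and $g(v)$ are infinite together. As a univariate function has a pole exactly when its value
on the branch is infinite (`isPoleUniv_iff_posDegree`), at each point of the orbit $f$ has a pole at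
$t_1$ if and only if $g$ has one at $t_2$.

Having poles therefore propagates between points with a common coordinate, and from the given pole
of $r$ to the whole orbit. The orbit then lies in the product of the finite pole sets of $f$ and
$g$, so it is not infinite.

The bulk of the work is the existence of branches. It rests on the Newton–Puiseux theorem, obtained
from Hensel lifting of coprime factorizations over $K[[t]]$, and on a valuation argument that
locates a root near a prescribed point of $\mathbb{P}^1$. -/

theorem exists_combination_of_isCoprime {g h e : K[X]} (hg : g.Monic) (hh : h.Monic)
    (hc : IsCoprime g h) (he : e.degree < (g * h).degree) :
    ∃ a b : K[X], a.degree < g.degree ∧ b.degree < h.degree ∧ a * h + g * b = e := by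
  obtain ⟨u, v, huv⟩ := hc
  -- Bézout gives $e = (eu)g + (ev)h$. Reducing $ev$ modulo $g$ bounds the degree of the first
  -- cofactor; the second is then the quotient, bounded by comparing degrees with $gh$.
  have hdvd : g ∣ e - (e * v) %ₘ g * h := by
    have h1 := modByMonic_add_div (e * v) g
    refine ⟨e * u + (e * v) /ₘ g * h, ?_⟩
    linear_combination (-e) * huv - h * h1
  obtain ⟨b, hb⟩ := hdvd
  have hlt : ((e * v) %ₘ g).degree < g.degree := degree_modByMonic_lt _ hg
  refine ⟨(e * v) %ₘ g, b, hlt, ?_, by linear_combination (-1 : K[X]) * hb⟩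
  have h2 : (g * b).degree < (g * h).degree := by
    rw [← hb]
    refine (degree_sub_le _ _).trans_lt (max_lt he ?_)
    rw [degree_mul, degree_mul]
    exact WithBot.add_lt_add_right (degree_ne_bot.2 hh.ne_zero) hlt
  rw [degree_mul, degree_mul] at h2
  exact lt_of_add_lt_add_left h2

/-- The sequence of pairs of polynomials defined by `(g, h)` in degree `0` and in degree `k + 1` by
solving, with `sol`, for the correction of `∑ Gᵢ Hⱼ` needed to reach `F (k + 1)`. -/
def henselSeq (F : ℕ → K[X]) (sol : K[X] → K[X] × K[X]) (g h : K[X]) : ℕ → K[X] × K[X]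
  | 0 => (g, h)
  | k + 1 => sol (F (k + 1) - ∑ i : Fin k,
      (henselSeq F sol g h (i + 1)).1 * (henselSeq F sol g h (k - i)).2)
termination_by k => k
decreasing_by all_goals omega

/-- The polynomial of degree at most `m` over `K⟦X⟧` whose reductions are the `G k`. -/
def packPoly (G : ℕ → K[X]) (m : ℕ) : (PowerSeries K)[X] :=
  ∑ i ∈ Finset.range (m + 1), monomial i (PowerSeries.mk fun k => (G k).coeff i)

theorem coeff_coeff_packPoly {G : ℕ → K[X]} {m : ℕ} (hG : ∀ k, (G k).natDegree ≤ m) (i k : ℕ) :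
    PowerSeries.coeff k ((packPoly G m).coeff i) = (G k).coeff i := by
  simp only [packPoly, finsetSum_coeff, coeff_monomial, Finset.sum_ite_eq', Finset.mem_range]
  split_ifs with h
  · simp
  · rw [coeff_eq_zero_of_natDegree_lt ((hG k).trans_lt (by omega)), map_zero]

/-- The corrections `G (k + 1)` have degree below that of `G 0`, so they leave the top coefficient
equal to the constant series 1. -/
theorem packPoly_monic {G : ℕ → K[X]} (h0 : (G 0).Monic)
    (hG : ∀ k, (G (k + 1)).degree < (G 0).degree) :
    (packPoly G (G 0).natDegree).Monic ∧
      (packPoly G (G 0).natDegree).natDegree = (G 0).natDegree := by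
  have hG' : ∀ k, (G k).natDegree ≤ (G 0).natDegree := fun k => by
    cases k with
    | zero => exact le_rfl
    | succ k => exact natDegree_le_natDegree (hG k).le
  have hc : (packPoly G (G 0).natDegree).coeff (G 0).natDegree = 1 := by
    ext k
    rw [coeff_coeff_packPoly hG', PowerSeries.coeff_one]
    cases k with
    | zero => rw [h0.coeff_natDegree, if_pos rfl]
    | succ k =>
      rw [coeff_eq_zero_of_degree_lt]
      · simp
      · rw [← degree_eq_natDegree h0.ne_zero]; exact hG k
  have hle : (packPoly G (G 0).natDegree).natDegree ≤ (G 0).natDegree := by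
    rw [natDegree_le_iff_coeff_eq_zero]
    intro i hi
    ext k
    rw [coeff_coeff_packPoly hG', coeff_eq_zero_of_natDegree_lt ((hG' k).trans_lt hi), map_zero]
  refine ⟨monic_of_natDegree_le_of_coeff_eq_one _ hle hc, le_antisymm hle ?_⟩
  exact le_natDegree_of_ne_zero (by rw [hc]; exact one_ne_zero)

/-- Hensel lifting, one power of the series variable at a time: in order $k+1$ the new unknowns
enter the product only through $G_{k+1}h+gH_{k+1}$, a linear problem solvable because $g$ and $h$
are coprime. -/
theorem exists_monic_mul_eq_of_isCoprime (f : (PowerSeries K)[X]) (hf : f.Monic) (g h : K[X])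
    (hg : g.Monic) (hh : h.Monic) (hc : IsCoprime g h)
    (hfgh : f.map (PowerSeries.constantCoeff (R := K)) = g * h) :
    ∃ G H : (PowerSeries K)[X], G.Monic ∧ H.Monic ∧ G.natDegree = g.natDegree ∧
      H.natDegree = h.natDegree ∧ G * H = f := by
  classical
  -- `sol` is made total by the value 0 when the degree is too large; `key` shows that this value is
  -- never relied on.
  have hsol : ∀ e : K[X], ∃ ab : K[X] × K[X], e.degree < (g * h).degree →
      ab.1.degree < g.degree ∧ ab.2.degree < h.degree ∧ ab.1 * h + g * ab.2 = e := by
    intro e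
    by_cases he : e.degree < (g * h).degree
    · obtain ⟨a, b, h1⟩ := exists_combination_of_isCoprime hg hh hc he
      exact ⟨(a, b), fun _ => h1⟩
    · exact ⟨0, fun h => absurd h he⟩
  choose sol hsol using hsol
  have hn : f.natDegree = (g * h).natDegree := by
    rw [← hfgh, hf.natDegree_map]
  let F : ℕ → K[X] := fun k =>
    ∑ i ∈ Finset.range (f.natDegree + 1), monomial i (PowerSeries.coeff k (f.coeff i))
  have hF : ∀ k i, (F k).coeff i = PowerSeries.coeff k (f.coeff i) := by
    intro k i
    simp only [F, finsetSum_coeff, coeff_monomial, Finset.sum_ite_eq', Finset.mem_range]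
    split_ifs with h
    · rfl
    · rw [coeff_eq_zero_of_natDegree_lt (by omega), map_zero]
  have hFdeg : ∀ k, (F (k + 1)).degree < (g * h).degree := by
    intro k
    rw [degree_eq_natDegree (hg.mul hh).ne_zero, ← hn, degree_lt_iff_coeff_zero]
    intro i hi
    rw [hF]
    rcases hi.eq_or_lt with rfl | hi
    · rw [hf.coeff_natDegree, PowerSeries.coeff_one, if_neg (by omega)]
    · rw [coeff_eq_zero_of_natDegree_lt hi, map_zero]
  let s := henselSeq F sol g h
  have s0 : s 0 = (g, h) := by simp only [s, henselSeq]
  have sS : ∀ k, s (k + 1) = sol (F (k + 1) - ∑ i : Fin k, (s (i + 1)).1 * (s (k - i)).2) := by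
    intro k
    simp only [s]
    rw [henselSeq]
  have key : ∀ k, (s (k + 1)).1.degree < g.degree ∧ (s (k + 1)).2.degree < h.degree ∧
      (s (k + 1)).1 * h + g * (s (k + 1)).2 =
        F (k + 1) - ∑ i : Fin k, (s (i + 1)).1 * (s (k - i)).2 := by
    intro k
    induction k using Nat.strong_induction_on with
    | _ k ih =>
      rw [sS]
      apply hsol
      refine (degree_sub_le _ _).trans_lt (max_lt (hFdeg k) ?_)
      refine (degree_sum_le _ _).trans_lt ?_
      rw [Finset.sup_lt_iff (bot_lt_iff_ne_bot.2 (degree_ne_bot.2 (hg.mul hh).ne_zero))]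
      intro i _
      have h1 := (ih i i.2).1
      have h2 := (ih (k - i - 1) (by omega)).2.1
      rw [show k - i - 1 + 1 = k - i by omega] at h2
      rw [degree_mul, degree_mul]
      exact (add_le_add le_rfl h2.le).trans_lt
        (WithBot.add_lt_add_right (degree_ne_bot.2 hh.ne_zero) h1)
  let G : ℕ → K[X] := fun k => (s k).1
  let H : ℕ → K[X] := fun k => (s k).2
  have G0 : G 0 = g := by simp only [G, s0]
  have H0 : H 0 = h := by simp only [H, s0]
  have hGd : ∀ k, (G (k + 1)).degree < (G 0).degree := fun k => by rw [G0]; exact (key k).1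
  have hHd : ∀ k, (H (k + 1)).degree < (H 0).degree := fun k => by rw [H0]; exact (key k).2.1
  have hG' : ∀ k, (G k).natDegree ≤ (G 0).natDegree := fun k => by
    cases k with
    | zero => exact le_rfl
    | succ k => exact natDegree_le_natDegree (hGd k).le
  have hH' : ∀ k, (H k).natDegree ≤ (H 0).natDegree := fun k => by
    cases k with
    | zero => exact le_rfl
    | succ k => exact natDegree_le_natDegree (hHd k).le
  have hsum : ∀ k, ∑ x ∈ Finset.HasAntidiagonal.antidiagonal k, G x.1 * H x.2 = F k := by
    intro k
    rw [Finset.Nat.sum_antidiagonal_eq_sum_range_succ (fun i j => G i * H j)]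
    cases k with
    | zero =>
      simp only [Finset.range_one, Finset.sum_singleton, Nat.sub_zero, G0, H0, ← hfgh]
      ext i
      rw [hF, coeff_map, PowerSeries.coeff_zero_eq_constantCoeff]
    | succ k =>
      -- The two end terms contain the new corrections; the terms in between are those subtracted in
      -- the recursion.
      rw [Finset.sum_range_succ, Finset.sum_range_succ', ← Fin.sum_univ_eq_sum_range
        (fun i => G (i + 1) * H (k + 1 - (i + 1)))]
      have h1 := (key k).2.2
      simp only [Nat.add_sub_add_right, Nat.sub_self, Nat.sub_zero, G0, H0]
      linear_combination h1
  refine ⟨packPoly G (G 0).natDegree, packPoly H (H 0).natDegree,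
    (packPoly_monic (G0 ▸ hg) hGd).1, (packPoly_monic (H0 ▸ hh) hHd).1,
    (packPoly_monic (G0 ▸ hg) hGd).2.trans (by rw [G0]),
    (packPoly_monic (H0 ▸ hh) hHd).2.trans (by rw [H0]), ?_⟩
  ext i k
  rw [← hF, ← hsum, finsetSum_coeff, coeff_mul, map_sum]
  simp only [PowerSeries.coeff_mul, coeff_coeff_packPoly hG', coeff_coeff_packPoly hH', coeff_mul]
  rw [Finset.sum_comm]

end Hensel

/-! ### The theorem of Newton and Puiseux -/

section NewtonPuiseux

variable {K : Type*} [Field K]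

/-- The substitution `t ↦ t ^ N` on Laurent series. -/
def ramify (N : ℕ+) : HahnSeries ℤ K →+* HahnSeries ℤ K :=
  HahnSeries.embDomainRingHom (AddMonoidHom.mulLeft (N : ℤ))
    (fun a b h => mul_left_cancel₀ (by positivity) h)
    (fun _ _ => mul_le_mul_iff_right₀ (by positivity))

/-- The embedding `t ↦ t ^ (1 / N)` of Laurent series into the series with rational exponents. -/
def toPuiseux (N : ℕ+) : HahnSeries ℤ K →+* HahnSeries ℚ K :=
  HahnSeries.embDomainRingHom
    ((AddMonoidHom.mulRight ((N : ℚ)⁻¹)).comp (Int.castAddHom ℚ))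
    (fun a b h => by
      have hN : ((N : ℚ)⁻¹) ≠ 0 := by positivity
      exact Int.cast_injective (mul_right_cancel₀ hN h))
    (fun a b => by
      have hN : 0 < ((N : ℚ)⁻¹) := by positivity
      simp [mul_le_mul_iff_left₀ hN])

theorem ramify_coeff (N : ℕ+) (x : HahnSeries ℤ K) (k : ℤ) :
    (ramify N x).coeff (N * k) = x.coeff k :=
  HahnSeries.embDomain_coeff (f := ⟨⟨AddMonoidHom.mulLeft (N : ℤ), _⟩, _⟩)

theorem exists_of_ramify_coeff_ne_zero {N : ℕ+} {x : HahnSeries ℤ K} {k : ℤ}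
    (h : (ramify N x).coeff k ≠ 0) : ∃ l, k = N * l ∧ x.coeff l ≠ 0 := by
  obtain ⟨l, hl, rfl⟩ := HahnSeries.support_embDomain_subset
    (f := ⟨⟨AddMonoidHom.mulLeft (N : ℤ), _⟩, _⟩) h
  exact ⟨l, rfl, hl⟩

theorem ramify_ramify (M N : ℕ+) (x : HahnSeries ℤ K) :
    ramify M (ramify N x) = ramify (M * N) x := by
  ext k
  by_cases hk : ∃ l : ℤ, k = M * (N * l)
  · obtain ⟨l, rfl⟩ := hk
    rw [ramify_coeff, ramify_coeff, ← mul_assoc]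
    have := ramify_coeff (M * N) x l
    push_cast at this
    rw [this]
  · have h1 : (ramify M (ramify N x)).coeff k = 0 := by
      by_contra h
      obtain ⟨l, rfl, h2⟩ := exists_of_ramify_coeff_ne_zero h
      obtain ⟨l, rfl, h3⟩ := exists_of_ramify_coeff_ne_zero h2
      exact hk ⟨l, rfl⟩
    rw [h1]
    by_contra h
    obtain ⟨l, rfl, h2⟩ := exists_of_ramify_coeff_ne_zero (Ne.symm h)
    exact hk ⟨l, by push_cast; ring⟩

theorem ramify_comp_ramify (M N : ℕ+) :
    (ramify M).comp (ramify N) = (ramify (M * N) : HahnSeries ℤ K →+* HahnSeries ℤ K) :=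
  RingHom.ext (ramify_ramify M N)

theorem toPuiseux_coeff (N : ℕ+) (x : HahnSeries ℤ K) (k : ℤ) :
    (toPuiseux N x).coeff (k * (N : ℚ)⁻¹) = x.coeff k :=
  HahnSeries.embDomain_coeff
    (f := ⟨⟨(AddMonoidHom.mulRight ((N : ℚ)⁻¹)).comp (Int.castAddHom ℚ), _⟩, _⟩)

theorem exists_of_toPuiseux_coeff_ne_zero {N : ℕ+} {x : HahnSeries ℤ K} {q : ℚ}
    (h : (toPuiseux N x).coeff q ≠ 0) : ∃ l : ℤ, q = l * (N : ℚ)⁻¹ ∧ x.coeff l ≠ 0 := by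
  obtain ⟨l, hl, rfl⟩ := HahnSeries.support_embDomain_subset
    (f := ⟨⟨(AddMonoidHom.mulRight ((N : ℚ)⁻¹)).comp (Int.castAddHom ℚ), _⟩, _⟩) h
  exact ⟨l, rfl, hl⟩

theorem isPuiseux_toPuiseux (N : ℕ+) (x : HahnSeries ℤ K) : IsPuiseux (toPuiseux N x) := by
  refine ⟨N, N.pos, fun q hq => ?_⟩
  obtain ⟨l, rfl, -⟩ := exists_of_toPuiseux_coeff_ne_zero hq
  exact ⟨l, (div_eq_mul_inv _ _).symm⟩

theorem toPuiseux_ramify (N : ℕ+) (x : HahnSeries ℤ K) :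
    toPuiseux N (ramify N x) = toPuiseux 1 x := by
  have hN : (N : ℚ) ≠ 0 := by positivity
  have e : ∀ l : ℤ, ((N * l : ℤ) : ℚ) * (N : ℚ)⁻¹ = l * ((1 : ℕ+) : ℚ)⁻¹ := by
    intro l; push_cast; field_simp
  ext k
  by_cases hk : ∃ l : ℤ, k = l * ((1 : ℕ+) : ℚ)⁻¹
  · obtain ⟨l, rfl⟩ := hk
    rw [toPuiseux_coeff, ← e, toPuiseux_coeff, ramify_coeff]
  · have h1 : (toPuiseux 1 x).coeff k = 0 := by
      by_contra h
      obtain ⟨l, rfl, h2⟩ := exists_of_toPuiseux_coeff_ne_zero h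
      exact hk ⟨l, rfl⟩
    rw [h1]
    by_contra h
    obtain ⟨l, rfl, h2⟩ := exists_of_toPuiseux_coeff_ne_zero h
    obtain ⟨l, rfl, h3⟩ := exists_of_ramify_coeff_ne_zero h2
    exact hk ⟨l, e l⟩

theorem toPuiseux_comp_ramify (N : ℕ+) :
    (toPuiseux N).comp (ramify N) = (toPuiseux 1 : HahnSeries ℤ K →+* HahnSeries ℚ K) :=
  RingHom.ext (toPuiseux_ramify N)

theorem toPuiseux_single (N : ℕ+) (k : ℤ) (a : K) :
    toPuiseux N (HahnSeries.single k a) = HahnSeries.single (k * (N : ℚ)⁻¹) a :=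
  HahnSeries.embDomain_single

theorem mem_range_ofPowerSeries {x : HahnSeries ℤ K} (hx : ∀ k < 0, x.coeff k = 0) :
    ∃ F : PowerSeries K, HahnSeries.ofPowerSeries ℤ K F = x := by
  refine ⟨PowerSeries.mk fun n => x.coeff n, ?_⟩
  ext k
  rw [PowerSeries.coeff_coe]
  split_ifs with h
  · rw [hx k h]
  · rw [PowerSeries.coeff_mk, Int.natAbs_of_nonneg (not_lt.1 h)]

/-- Scaling the roots back by $s^{-1}$ is, up to a constant factor, the substitution $X\mapsto sX$,
which preserves splitting. -/
theorem splits_of_splits_scaleRoots {L : Type*} [Field L] {f : L[X]} {s : L} (hs : s ≠ 0)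
    (h : (f.scaleRoots s).Splits) : f.Splits := by
  have e : ∀ g : L[X], g.scaleRoots s⁻¹ = C (s⁻¹ ^ g.natDegree) * g.comp (C s * X) := by
    intro g
    ext i
    rw [coeff_scaleRoots, coeff_C_mul, comp_C_mul_X_coeff]
    rcases le_or_gt i g.natDegree with hi | hi
    · obtain ⟨d, hd⟩ := Nat.exists_eq_add_of_le hi
      rw [hd, Nat.add_sub_cancel_left, pow_add]
      have : s⁻¹ ^ i * s ^ i = 1 := by rw [← mul_pow, inv_mul_cancel₀ hs, one_pow]
      linear_combination (-(g.coeff i * s⁻¹ ^ d)) * this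
    · rw [coeff_eq_zero_of_natDegree_lt hi]; simp
  have h2 : f = (f.scaleRoots s).scaleRoots s⁻¹ := by
    rw [← scaleRoots_mul, mul_inv_cancel₀ hs, scaleRoots_one]
  rw [h2, e]
  refine Splits.C_mul (Splits.comp_of_natDegree_le_one h ?_) _
  exact natDegree_C_mul_le s X |>.trans natDegree_X_le

variable [CharZero K]

/-- A monic polynomial over an algebraically closed field whose roots have sum zero is a power of
`X` or a product of two coprime polynomials of smaller degree. -/
theorem exists_coprime_factors [IsAlgClosed K] {f : K[X]} (hf : f.Monic) (hn : f.natDegree ≠ 0)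
    (h0 : f.coeff (f.natDegree - 1) = 0) (hX : f ≠ X ^ f.natDegree) :
    ∃ g h : K[X], g.Monic ∧ h.Monic ∧ IsCoprime g h ∧ f = g * h ∧
      g.natDegree < f.natDegree ∧ h.natDegree < f.natDegree := by
  obtain ⟨c, hc⟩ := IsAlgClosed.exists_root f (by
    rw [degree_eq_natDegree hf.ne_zero]; exact_mod_cast hn)
  obtain ⟨q, hq, hq'⟩ := exists_eq_pow_rootMultiplicity_mul_and_not_dvd f hf.ne_zero c
  have hm : 0 < f.rootMultiplicity c := (rootMultiplicity_pos hf.ne_zero).2 hc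
  set m := f.rootMultiplicity c
  have hpm : ((X - C c) ^ m).Monic := (monic_X_sub_C c).pow m
  have hqm : q.Monic := hpm.of_mul_monic_left (hq ▸ hf)
  have hdeg : f.natDegree = m + q.natDegree := by
    conv_lhs => rw [hq, hpm.natDegree_mul hqm, (monic_X_sub_C c).natDegree_pow, natDegree_X_sub_C, mul_one]
  refine ⟨_, q, hpm, hqm, ((irreducible_X_sub_C c).coprime_iff_not_dvd.2 hq').pow_left, hq, ?_,
    by omega⟩
  rw [(monic_X_sub_C c).natDegree_pow, natDegree_X_sub_C, mul_one]
  -- Otherwise $f=(X-c)^n$, whose coefficient of $X^{n-1}$ is $-nc$; in characteristic 0 its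
  -- vanishing forces $c=0$.
  by_contra hlt
  have hq1 : q = 1 := eq_one_of_monic_natDegree_zero hqm (by omega)
  rw [hq1, mul_one] at hq
  have hmn : m = f.natDegree := by omega
  rw [hmn] at hq
  have h1 : f.coeff (f.natDegree - 1) = ((X + C (-c)) ^ f.natDegree).coeff (f.natDegree - 1) := by
    conv_lhs => rw [hq]
    rw [C_neg, ← sub_eq_add_neg, ← hq]
  rw [h1, coeff_X_add_C_pow, Nat.sub_sub_self (by omega), pow_one,
    Nat.choose_symm (by omega), Nat.choose_one_right] at h0
  have hc0 : c = 0 := by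
    rcases mul_eq_zero.1 h0 with h | h
    · simpa using h
    · exact absurd (by exact_mod_cast h) hn
  rw [hc0, C_0, sub_zero] at hq
  exact hX hq

/-- The Newton polygon step. Let $i_0$ minimize the slope $\operatorname{ord}(a_i)/(n-i)$ and put
$A=\operatorname{ord}(a_{i_0})$, $N=n-i_0$. After $t\mapsto t^N$ and scaling the roots by $t^{-A}$,
the $i$-th coefficient has order $N\operatorname{ord}(a_i)-A(n-i)\ge 0$, with equality at $i_0$. The
reduction at $t=0$ is thus monic, not $X^n$, and has no $X^{n-1}$ term: it factors into coprime
parts, which Hensel's lemma lifts. -/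
theorem exists_scaled_factors [IsAlgClosed K] {f : (HahnSeries ℤ K)[X]} (hf : f.Monic)
    (hn : f.natDegree ≠ 0) (h0 : f.coeff (f.natDegree - 1) = 0) (hX : f ≠ X ^ f.natDegree) :
    ∃ (N : ℕ+) (s : HahnSeries ℤ K) (G H : (HahnSeries ℤ K)[X]), s ≠ 0 ∧ G.Monic ∧ H.Monic ∧
      (f.map (ramify N)).scaleRoots s = G * H ∧
      G.natDegree < f.natDegree ∧ H.natDegree < f.natDegree := by
  classical
  obtain ⟨i₀, hi₀, hmin⟩ := Finset.exists_min_image (f.support.erase f.natDegree)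
    (fun i => ((f.coeff i).order : ℚ) / ((f.natDegree - i : ℕ) : ℚ)) (by
      rw [Finset.nonempty_iff_ne_empty]
      intro he
      refine hX ?_
      ext1 i
      rw [coeff_X_pow]
      split_ifs with hi
      · rw [hi]; exact hf.coeff_natDegree
      · by_contra hne
        have : i ∈ f.support.erase f.natDegree := Finset.mem_erase.2 ⟨hi, mem_support_iff.2 hne⟩
        simp [he] at this)
  have hlt : ∀ i ∈ f.support.erase f.natDegree, i < f.natDegree := fun i hi =>
    lt_of_le_of_ne (le_natDegree_of_mem_supp _ (Finset.mem_of_mem_erase hi))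
      (Finset.ne_of_mem_erase hi)
  have hi₀n := hlt i₀ hi₀
  have hi₀c : f.coeff i₀ ≠ 0 := mem_support_iff.1 (Finset.mem_of_mem_erase hi₀)
  let N : ℕ+ := ⟨f.natDegree - i₀, by omega⟩
  have hNv : (N : ℕ) = f.natDegree - i₀ := rfl
  let A : ℤ := (f.coeff i₀).order
  let s : HahnSeries ℤ K := HahnSeries.single (-A) 1
  have hs : s ≠ 0 := by simp [s]
  have hord : ∀ i < f.natDegree, f.coeff i ≠ 0 →
      A * ((f.natDegree - i : ℕ) : ℤ) ≤ (N : ℤ) * (f.coeff i).order := by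
    intro i hi hc
    have h1 := hmin i (Finset.mem_erase.2 ⟨hi.ne, mem_support_iff.2 hc⟩)
    have p1 : (0 : ℚ) < ((f.natDegree - i : ℕ) : ℚ) := by
      exact_mod_cast (by omega : 0 < f.natDegree - i)
    have p2 : (0 : ℚ) < ((f.natDegree - i₀ : ℕ) : ℚ) := by
      exact_mod_cast (by omega : 0 < f.natDegree - i₀)
    rw [div_le_div_iff₀ p2 p1] at h1
    rw [mul_comm (N : ℤ)]
    exact_mod_cast h1
  have hfm : (f.map (ramify N)).natDegree = f.natDegree := hf.natDegree_map _
  set f₁ := (f.map (ramify N)).scaleRoots s with hf₁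
  have hf₁m : f₁.Monic := (monic_scaleRoots_iff _).2 (hf.map _)
  have hf₁d : f₁.natDegree = f.natDegree := by rw [hf₁, natDegree_scaleRoots, hfm]
  have hcoeff : ∀ i k, (f₁.coeff i).coeff k =
      (ramify N (f.coeff i)).coeff (k + A * ((f.natDegree - i : ℕ) : ℤ)) := by
    intro i k
    rw [hf₁, coeff_scaleRoots, coeff_map, hfm, HahnSeries.single_pow, one_pow,
      HahnSeries.coeff_mul_single, mul_one]
    congr 1
    simp only [nsmul_eq_mul]
    ring
  have hlift : f₁ ∈ lifts (HahnSeries.ofPowerSeries ℤ K) := by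
    rw [lifts_iff_coeff_lifts]
    intro i
    obtain ⟨F, hF⟩ := mem_range_ofPowerSeries (x := f₁.coeff i) (by
      intro k hk
      rcases lt_trichotomy i f.natDegree with hi | rfl | hi
      · rw [hcoeff]
        by_contra hne
        obtain ⟨l, hl, hl'⟩ := exists_of_ramify_coeff_ne_zero hne
        have h1 := hord i hi (HahnSeries.ne_zero_of_coeff_ne_zero hl')
        have h2 := HahnSeries.order_le_of_coeff_ne_zero hl'
        have h3 : (N : ℤ) * (f.coeff i).order ≤ N * l :=
          mul_le_mul_of_nonneg_left h2 (by positivity)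
        linarith
      · rw [← hf₁d, hf₁m.coeff_natDegree, HahnSeries.coeff_one, if_neg hk.ne]
      · rw [coeff_eq_zero_of_natDegree_lt (by omega), HahnSeries.coeff_zero])
    exact ⟨F, hF⟩
  obtain ⟨g, hg, hgd, hgm⟩ := lifts_and_natDegree_eq_and_monic hlift hf₁m
  have hgc : ∀ i, (g.map (PowerSeries.constantCoeff (R := K))).coeff i = (f₁.coeff i).coeff 0 := by
    intro i
    rw [← hg, coeff_map, coeff_map, PowerSeries.coeff_coe, if_neg (lt_irrefl _), Int.natAbs_zero,
      PowerSeries.coeff_zero_eq_constantCoeff]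
  have hbm := hgm.map (PowerSeries.constantCoeff (R := K))
  have hbd : (g.map (PowerSeries.constantCoeff (R := K))).natDegree = f.natDegree := by
    rw [hgm.natDegree_map, hgd, hf₁d]
  obtain ⟨G, H, hG, hH, hGH, hfGH, hGd, hHd⟩ := exists_coprime_factors hbm (hbd ▸ hn)
    (by rw [hbd, hgc, hcoeff, h0, map_zero, HahnSeries.coeff_zero])
    -- The coefficient of the reduction at $i_0$ is the lowest coefficient of $a_{i_0}$, which is
    -- nonzero.
    (by
      intro he
      have h1 := congrArg (fun p => p.coeff i₀) he
      simp only [hbd, coeff_X_pow, if_neg hi₀n.ne, hgc, hcoeff] at h1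
      rw [zero_add, ← hNv, mul_comm, ramify_coeff] at h1
      exact HahnSeries.coeff_order_eq_zero.not.2 hi₀c h1)
  obtain ⟨G', H', hG', hH', hGd', hHd', hmul⟩ := exists_monic_mul_eq_of_isCoprime g hgm G H hG hH
    hGH hfGH
  refine ⟨N, s, G'.map (HahnSeries.ofPowerSeries ℤ K), H'.map (HahnSeries.ofPowerSeries ℤ K), hs,
    hG'.map _, hH'.map _, ?_, ?_, ?_⟩
  · rw [← Polynomial.map_mul, hmul, hg]
  · rw [hG'.natDegree_map, hGd', ← hbd]; exact hGd
  · rw [hH'.natDegree_map, hHd', ← hbd]; exact hHd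

/-- The Tschirnhaus shift by the mean of the roots: the shifted coefficient is $a_{n-1}+nc$. -/
theorem exists_taylor_coeff_eq_zero {L : Type*} [Field L] [CharZero L] {f : L[X]} (hf : f.Monic)
    (hn : f.natDegree ≠ 0) : ∃ c, (taylor c f).coeff (f.natDegree - 1) = 0 := by
  have hn' : (f.natDegree : L) ≠ 0 := by exact_mod_cast hn
  refine ⟨-(f.coeff (f.natDegree - 1)) / f.natDegree, ?_⟩
  rw [taylor_coeff, eval_eq_sum_range' (n := 2)
    (by have := natDegree_hasseDeriv_le f (f.natDegree - 1); omega)]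
  rw [Finset.sum_range_succ, Finset.sum_range_one, hasseDeriv_coeff, hasseDeriv_coeff,
    zero_add, Nat.choose_self, add_comm 1, Nat.sub_add_cancel (by omega), hf.coeff_natDegree,
    Nat.choose_symm (by omega), Nat.choose_one_right]
  push_cast
  field_simp
  ring

/-- Strong induction on the degree: after the Tschirnhaus shift the polynomial is a power of $X$,
or, after ramification and scaling, a product of factors of smaller degree. -/
theorem exists_splits_map_ramify [IsAlgClosed K] {f : (HahnSeries ℤ K)[X]} (hf : f.Monic) :
    ∃ N : ℕ+, (f.map (ramify N)).Splits := by
  induction hn : f.natDegree using Nat.strong_induction_on generalizing f with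
  | _ n ih =>
    subst hn
    by_cases hn : f.natDegree = 0
    · exact ⟨1, Splits.of_natDegree_eq_zero (by rw [hf.natDegree_map, hn])⟩
    have : CharZero (HahnSeries ℤ K) :=
      charZero_of_injective_ringHom (HahnSeries.C_injective (Γ := ℤ) (R := K))
    obtain ⟨c, hc⟩ := exists_taylor_coeff_eq_zero hf hn
    set f₂ := taylor c f with hf₂
    have hd₂ : f₂.natDegree = f.natDegree := natDegree_taylor _ _
    have hm₂ : f₂.Monic := by
      rw [Monic, leadingCoeff, hd₂, hf₂, coeff_taylor_natDegree, hf.leadingCoeff]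
    suffices h : ∃ N : ℕ+, (f₂.map (ramify N)).Splits by
      obtain ⟨N, hN⟩ := h
      refine ⟨N, ?_⟩
      have e : f.map (ramify N) = (f₂.map (ramify N)).comp (X + C (ramify N (-c))) := by
        have : f = f₂.comp (X + C (-c)) := by
          rw [hf₂, taylor_apply, comp_assoc]
          simp
        conv_lhs => rw [this, Polynomial.map_comp]
        simp
      rw [e]
      exact hN.comp_X_add_C _
    by_cases hX : f₂ = X ^ f₂.natDegree
    · refine ⟨1, ?_⟩
      rw [hX, Polynomial.map_pow, map_X]
      exact Splits.X_pow _
    obtain ⟨N, s, G, H, hs, hG, hH, hGH, hGd, hHd⟩ :=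
      exists_scaled_factors hm₂ (hd₂ ▸ hn) (hd₂.symm ▸ hc) hX
    obtain ⟨M₁, h₁⟩ := ih _ (hd₂ ▸ hGd) hG rfl
    obtain ⟨M₂, h₂⟩ := ih _ (hd₂ ▸ hHd) hH rfl
    -- $N$ makes the factorization possible and $M_1$, $M_2$ split the two factors; further
    -- ramification preserves splitting.
    refine ⟨M₁ * M₂ * N, ?_⟩
    have hs' : ramify (M₁ * M₂) s ≠ 0 := (_root_.map_ne_zero _).2 hs
    apply splits_of_splits_scaleRoots hs'
    rw [← ramify_comp_ramify, ← Polynomial.map_map, ← map_scaleRoots _ _ _ (by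
      rw [(hm₂.map _).leadingCoeff, map_one]; exact one_ne_zero), hGH, Polynomial.map_mul]
    refine Splits.mul ?_ ?_
    · rw [mul_comm, ← ramify_comp_ramify, ← Polynomial.map_map]
      exact h₁.map _
    · rw [← ramify_comp_ramify, ← Polynomial.map_map]
      exact h₂.map _

/-- **Newton–Puiseux**: a polynomial over the field of Laurent series splits over the Puiseux
series. -/
theorem exists_splits_map_toPuiseux [IsAlgClosed K] (f : (HahnSeries ℤ K)[X]) (hf : f ≠ 0) :
    (f.map (toPuiseux 1)).Splits ∧
      ∃ N : ℕ+, ∀ φ, (f.map (toPuiseux 1)).IsRoot φ → ∃ x, φ = toPuiseux N x := by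
  have hm := monic_mul_leadingCoeff_inv hf
  obtain ⟨N, hN⟩ := exists_splits_map_ramify hm
  have hN' : (f.map (ramify N)).Splits := by
    have e : f = f * C f.leadingCoeff⁻¹ * C f.leadingCoeff := by
      rw [mul_assoc, ← C_mul, inv_mul_cancel₀ (leadingCoeff_ne_zero.2 hf), C_1, mul_one]
    rw [e, Polynomial.map_mul, map_C]
    exact hN.mul (Splits.C _)
  -- Once split over Laurent series in $t^{1/N}$, the polynomial has all its roots there, which
  -- gives one common denominator of exponents.
  rw [← toPuiseux_comp_ramify N, ← Polynomial.map_map]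
  refine ⟨hN'.map _, N, fun φ hφ => ?_⟩
  obtain ⟨x, hx⟩ := hN'.mem_range_of_isRoot (i := toPuiseux N)
    (Polynomial.map_ne_zero hf) hφ
  exact ⟨x, hx.symm⟩

end NewtonPuiseux

/-! ### Integral series and their residues -/

section Integers

variable {K : Type*} [Field K]

theorem algebraMap_hahnSeries {Γ : Type*} [Semiring Γ] [PartialOrder Γ] [IsStrictOrderedRing Γ]
    (a : K) : algebraMap K (HahnSeries Γ K) a = HahnSeries.single 0 a := by
  rw [HahnSeries.algebraMap_apply']
  exact HahnSeries.ofPowerSeries_C a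

theorem orderTop_algebraMap_nonneg (a : K) :
    0 ≤ (algebraMap K (HahnSeries ℚ K) a).orderTop := by
  rw [algebraMap_hahnSeries]
  exact HahnSeries.orderTop_single_le

variable (K) in
/-- The series with nonnegative exponents. -/
def integers : Subalgebra K (HahnSeries ℚ K) where
  carrier := {x | 0 ≤ x.orderTop}
  mul_mem' {x y} hx hy := by
    rw [Set.mem_ofPred_eq] at *
    rw [HahnSeries.orderTop_mul]
    exact add_nonneg hx hy
  add_mem' {x y} hx hy := by
    rw [Set.mem_ofPred_eq] at *
    exact (le_min hx hy).trans HahnSeries.min_orderTop_le_orderTop_add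
  algebraMap_mem' := orderTop_algebraMap_nonneg

theorem mem_integers {x : HahnSeries ℚ K} : x ∈ integers K ↔ 0 ≤ x.orderTop :=
  Iff.of_eq Set.mem_ofPred_eq

theorem coeff_zero_of_orderTop_pos {x : HahnSeries ℚ K} (hx : 0 < x.orderTop) :
    x.coeff 0 = 0 := HahnSeries.coeff_eq_zero_of_lt_orderTop (by simpa using hx)

theorem orderTop_pos_iff {x : HahnSeries ℚ K} (hx : 0 ≤ x.orderTop) :
    0 < x.orderTop ↔ x.coeff 0 = 0 :=
  ⟨coeff_zero_of_orderTop_pos, fun h =>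
    lt_of_le_of_ne hx (Ne.symm (by simpa using HahnSeries.orderTop_ne_of_coeff_eq_zero h))⟩

/-- Each factor is its constant term plus a series of positive order, and the cross terms have
positive order. -/
theorem coeff_zero_mul {x y : HahnSeries ℚ K} (hx : 0 ≤ x.orderTop) (hy : 0 ≤ y.orderTop) :
    (x * y).coeff 0 = x.coeff 0 * y.coeff 0 := by
  have key : ∀ {z : HahnSeries ℚ K}, 0 ≤ z.orderTop →
      0 < (z - algebraMap K _ (z.coeff 0)).orderTop := by
    intro z hz
    rw [orderTop_pos_iff (mem_integers.1 (sub_mem (mem_integers.2 hz)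
      ((integers K).algebraMap_mem _)))]
    rw [HahnSeries.coeff_sub, algebraMap_hahnSeries,
      HahnSeries.coeff_single_same, sub_self]
  have e : x * y = algebraMap K _ (x.coeff 0) * algebraMap K _ (y.coeff 0) +
      ((x - algebraMap K _ (x.coeff 0)) * y +
        algebraMap K _ (x.coeff 0) * (y - algebraMap K _ (y.coeff 0))) := by ring
  have h1 : 0 < ((x - algebraMap K _ (x.coeff 0)) * y).orderTop := by
    rw [HahnSeries.orderTop_mul]
    exact (key hx).trans_le (le_add_of_nonneg_right hy)
  have h2 : 0 < (algebraMap K _ (x.coeff 0) * (y - algebraMap K _ (y.coeff 0))).orderTop := by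
    rw [HahnSeries.orderTop_mul]
    exact (key hy).trans_le (le_add_of_nonneg_left (orderTop_algebraMap_nonneg _))
  rw [e, HahnSeries.coeff_add, HahnSeries.coeff_add, coeff_zero_of_orderTop_pos h1,
    coeff_zero_of_orderTop_pos h2, ← map_mul, algebraMap_hahnSeries,
    HahnSeries.coeff_single_same, add_zero, add_zero]

variable (K) in
/-- The constant coefficient of an integral series. -/
def res : integers K →ₐ[K] K where
  toFun x := (x : HahnSeries ℚ K).coeff 0
  map_one' := by simp
  map_mul' x y := coeff_zero_mul (mem_integers.1 x.2) (mem_integers.1 y.2)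
  map_zero' := rfl
  map_add' _ _ := rfl
  commutes' a := by
    change (algebraMap K (HahnSeries ℚ K) a).coeff 0 = a
    rw [algebraMap_hahnSeries, HahnSeries.coeff_single_same]

theorem res_eq_zero_iff {x : integers K} : res K x = 0 ↔ 0 < (x : HahnSeries ℚ K).orderTop :=
  (orderTop_pos_iff (mem_integers.1 x.2)).symm

theorem orderTop_eq_zero_of_res_ne_zero {x : integers K} (h : res K x ≠ 0) :
    (x : HahnSeries ℚ K).orderTop = 0 :=
  le_antisymm (not_lt.1 (res_eq_zero_iff.not.1 h)) (mem_integers.1 x.2)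

theorem orderTop_add_orderTop_inv {x : HahnSeries ℚ K} (hx : x ≠ 0) :
    x.orderTop + x⁻¹.orderTop = 0 := by
  rw [← HahnSeries.orderTop_mul, mul_inv_cancel₀ hx, HahnSeries.orderTop_one]

theorem orderTop_inv_pos {x : HahnSeries ℚ K} (h : x.orderTop < 0) : 0 < x⁻¹.orderTop := by
  have hx : x ≠ 0 := by rintro rfl; simp at h
  have := orderTop_add_orderTop_inv hx
  by_contra hle
  exact absurd this (add_neg_of_neg_of_nonpos h (not_lt.1 hle)).ne

theorem orderTop_inv_neg {x : HahnSeries ℚ K} (hx : x ≠ 0) (h : 0 < x.orderTop) :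
    x⁻¹.orderTop < 0 := by
  have := orderTop_add_orderTop_inv hx
  by_contra hle
  exact absurd this (add_pos_of_pos_of_nonneg h (not_lt.1 hle)).ne'

theorem orderTop_div_nonneg {x y : integers K} (hy : res K y ≠ 0) :
    0 ≤ ((x : HahnSeries ℚ K) / y).orderTop := by
  have hy0 : (y : HahnSeries ℚ K) ≠ 0 := by
    rintro h; apply hy; rw [res_eq_zero_iff, h]; simp
  have h1 := orderTop_add_orderTop_inv hy0
  rw [orderTop_eq_zero_of_res_ne_zero hy, zero_add] at h1
  rw [div_eq_mul_inv, HahnSeries.orderTop_mul, h1, add_zero]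
  exact mem_integers.1 x.2

theorem orderTop_div_neg {x y : integers K} (hx : res K x ≠ 0) (hy : res K y = 0)
    (hy0 : (y : HahnSeries ℚ K) ≠ 0) : ((x : HahnSeries ℚ K) / y).orderTop < 0 := by
  rw [div_eq_mul_inv, HahnSeries.orderTop_mul, orderTop_eq_zero_of_res_ne_zero hx, zero_add]
  exact orderTop_inv_neg hy0 (res_eq_zero_iff.1 hy)

/-- Elements of an extension field outside an algebraically closed field are transcendental. -/
theorem aeval_ne_zero_of_notMem_range [IsAlgClosed K] {L : Type*} [Field L] [Algebra K L] {u : L}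
    (hu : u ∉ (algebraMap K L).range) {h : K[X]} (hh : h ≠ 0) : aeval u h ≠ 0 := by
  intro h0
  refine hu ((IsAlgClosed.splits h).mem_range_of_isRoot hh ?_)
  rwa [IsRoot.def, eval_map_algebraMap]

theorem notMem_range_of_orderTop_neg {x : HahnSeries ℚ K} (hx : x.orderTop < 0) :
    x ∉ (algebraMap K (HahnSeries ℚ K)).range := by
  rintro ⟨a, rfl⟩
  exact absurd (orderTop_algebraMap_nonneg a) (not_le.2 hx)

end Integers

/-! ### Local coordinates at the points of the projective line -/

section Chart

variable {K : Type*} [Field K]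

/-- A transformation of `ℙ¹` that maps `∞` to the given point. -/
def chart : OnePoint K → GL (Fin 2) K
  | ∞ => 1
  | (a : K) => Matrix.GeneralLinearGroup.mkOfDetNeZero !![a, 1; 1, 0]
      (by simp [Matrix.det_fin_two_of])

theorem chart_smul_infty [DecidableEq K] (c : OnePoint K) : chart c • (∞ : OnePoint K) = c := by
  induction c using OnePoint.rec with
  | infty => exact one_smul _ _
  | coe a =>
    rw [OnePoint.smul_infty_eq_ite]
    simp [chart, Matrix.GeneralLinearGroup.mkOfDetNeZero]

theorem moebius_chart_infty {L : Type*} [Field L] [Algebra K L] (u : L) :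
    moebius (chart (∞ : OnePoint K)) u = u := by
  change moebius (1 : GL (Fin 2) K) u = u
  simp [moebius]

theorem moebius_chart_coe {L : Type*} [Field L] [Algebra K L] (a : K) {u : L} (hu : u ≠ 0) :
    moebius (chart (a : OnePoint K)) u = u⁻¹ + algebraMap K L a := by
  simp only [moebius, chart, Matrix.GeneralLinearGroup.mkOfDetNeZero]
  simp [Matrix.GeneralLinearGroup.mk', Matrix.unitOfDetInvertible]
  field_simp
  ring

theorem map_moebius {L L' : Type*} [Field L] [Algebra K L] [Field L'] [Algebra K L']
    (ψ : L →ₐ[K] L') (A : GL (Fin 2) K) (u : L) : ψ (moebius A u) = moebius A (ψ u) := by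
  simp [moebius, AlgHom.commutes]

/-- The value at a point of `ℙ¹` of the homogenization of degree `N` of a polynomial. -/
def homEval (c : OnePoint K) (N : ℕ) (h : K[X]) : K :=
  ∑ i ∈ Finset.range (N + 1), h.coeff i * (coord₀ c ^ (N - i) * coord₁ c ^ i)

theorem homEval_infty (N : ℕ) (h : K[X]) : homEval ∞ N h = h.coeff N := by
  rw [homEval, Finset.sum_range_succ, Finset.sum_eq_zero]
  · simp [coord₀, coord₁]
  · intro i hi
    have : N - i ≠ 0 := by have := Finset.mem_range.1 hi; omega
    simp [coord₀, this]

theorem homEval_coe (a : K) {N : ℕ} {h : K[X]} (hN : h.natDegree ≤ N) :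
    homEval (a : OnePoint K) N h = h.eval a := by
  rw [homEval, eval_eq_sum_range' (Nat.lt_succ_of_le hN)]
  simp [coord₀, coord₁]

theorem aeval_mem_integers {w : HahnSeries ℚ K} (hw : 0 < w.orderTop) (h : K[X]) :
    ∃ z : integers K, aeval w h = z ∧ res K z = h.coeff 0 := by
  let w' : integers K := ⟨w, mem_integers.2 hw.le⟩
  refine ⟨aeval w' h, ?_, ?_⟩
  · exact aeval_algHom_apply (integers K).val w' h
  · rw [← aeval_algHom_apply, show res K w' = 0 from res_eq_zero_iff.2 hw, coe_aeval_eq_eval,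
      coeff_zero_eq_eval_zero]

/-- Near a point `c` of `ℙ¹`, the polynomials of degree at most `N` have, up to a common factor,
integral values, with residue the value at `c` of the homogenization. -/
theorem exists_aeval_moebius_chart_eq {φ : HahnSeries ℚ K} (hφ : φ.orderTop < 0)
    (c : OnePoint K) (N : ℕ) : ∃ s : HahnSeries ℚ K, s ≠ 0 ∧ ∀ h : K[X], h.natDegree ≤ N →
      ∃ z : integers K, aeval (moebius (chart c) φ) h = s * z ∧ res K z = homEval c N h := by
  have hφ0 : φ ≠ 0 := by rintro rfl; simp at hφ
  have hw := orderTop_inv_pos hφ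
  induction c using OnePoint.rec with
  | infty =>
    -- At $\infty$, pulling out $\varphi^N$ leaves the reversed polynomial evaluated at
    -- $\varphi^{-1}$, which has positive order.
    refine ⟨φ ^ N, pow_ne_zero _ hφ0, fun h hh => ?_⟩
    obtain ⟨z, hz, hz'⟩ := aeval_mem_integers hw (reflect N h)
    refine ⟨z, ?_, ?_⟩
    · let _ := invertibleOfNonzero hφ0
      rw [← hz, moebius_chart_infty, aeval_def, aeval_def, mul_comm, ← invOf_eq_inv,
        eval₂_reflect_mul_pow _ _ _ _ hh]
    · rw [hz', homEval_infty, coeff_reflect, revAt_le (Nat.zero_le _), Nat.sub_zero]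
  | coe a =>
    -- At a finite $a$ the coordinate is $a+\varphi^{-1}$, so the Taylor expansion at $a$ is already
    -- integral.
    refine ⟨1, one_ne_zero, fun h hh => ?_⟩
    obtain ⟨z, hz, hz'⟩ := aeval_mem_integers hw (taylor a h)
    refine ⟨z, ?_, ?_⟩
    · rw [← hz, moebius_chart_coe a hφ0, one_mul, taylor_apply, aeval_comp]
      simp
    · rw [hz', homEval_coe a hh, taylor_coeff_zero]

theorem moebius_chart_notMem_range {φ : HahnSeries ℚ K} (hφ : φ.orderTop < 0) (c : OnePoint K) :
    moebius (chart c) φ ∉ (algebraMap K (HahnSeries ℚ K)).range := by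
  have hφ0 : φ ≠ 0 := by rintro rfl; simp at hφ
  have h1 := notMem_range_of_orderTop_neg hφ
  induction c using OnePoint.rec with
  | infty => rwa [moebius_chart_infty]
  | coe a =>
    rw [moebius_chart_coe a hφ0]
    rintro ⟨b, hb⟩
    exact h1 ⟨(b - a)⁻¹, by rw [map_inv₀, map_sub, hb, add_sub_cancel_right, inv_inv]⟩

/-- The value of a univariate rational function. -/
def ratEval {L : Type*} [Field L] [Algebra K L] (u : L) (f : RatFunc K) : L :=
  aeval u f.num / aeval u f.denom

/-- Homogenized in the larger of their degrees, numerator and denominator have no common zero on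
$\mathbb{P}^1$: at finite points by coprimality, at $\infty$ because one of them attains that
degree. -/
theorem homEval_num_ne_zero_or (f : RatFunc K) (c : OnePoint K) :
    homEval c (max f.num.natDegree f.denom.natDegree) f.num ≠ 0 ∨
      homEval c (max f.num.natDegree f.denom.natDegree) f.denom ≠ 0 := by
  induction c using OnePoint.rec with
  | infty =>
    rw [homEval_infty, homEval_infty]
    rcases le_or_gt f.num.natDegree f.denom.natDegree with h | h
    · right
      rw [max_eq_right h]
      exact leadingCoeff_ne_zero.2 f.denom_ne_zero
    · left
      rw [max_eq_left h.le]
      exact leadingCoeff_ne_zero.2 (by intro h0; simp [h0] at h)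
  | coe a =>
    rw [homEval_coe a (le_max_left _ _), homEval_coe a (le_max_right _ _)]
    by_contra! hcon
    obtain ⟨u, v, huv⟩ := f.isCoprime_num_denom
    have := congrArg (eval a) huv
    simp [hcon.1, hcon.2] at this

/-- This treats the finite and infinite cases of a pole uniformly. -/
theorem isPoleUniv_iff (f : RatFunc K) (c : OnePoint K) :
    IsPoleUniv f c ↔ homEval c (max f.num.natDegree f.denom.natDegree) f.denom = 0 := by
  induction c using OnePoint.rec with
  | infty =>
    rw [homEval_infty]
    change f.denom.natDegree < f.num.natDegree ↔ _
    rcases le_or_gt f.num.natDegree f.denom.natDegree with h | h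
    · rw [max_eq_right h]
      exact ⟨fun h' => absurd h' (not_lt.2 h),
        fun h' => absurd h' (leadingCoeff_ne_zero.2 f.denom_ne_zero)⟩
    · rw [max_eq_left h.le]
      exact ⟨fun h' => coeff_eq_zero_of_natDegree_lt h', fun _ => h⟩
  | coe a =>
    rw [homEval_coe a (le_max_right _ _)]
    exact Iff.rfl

/-- A univariate rational function has a pole at `c` if and only if its values near `c` are
infinitely large. -/
theorem isPoleUniv_iff_posDegree [IsAlgClosed K] {φ : HahnSeries ℚ K} (hφ : φ.orderTop < 0)
    (c : OnePoint K) (f : RatFunc K) :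
    IsPoleUniv f c ↔ PosDegree (ratEval (moebius (chart c) φ) f) := by
  rw [isPoleUniv_iff]
  obtain ⟨s, hs, h⟩ := exists_aeval_moebius_chart_eq hφ c (max f.num.natDegree f.denom.natDegree)
  obtain ⟨z₁, hz₁, hr₁⟩ := h f.num (le_max_left _ _)
  obtain ⟨z₂, hz₂, hr₂⟩ := h f.denom (le_max_right _ _)
  have hne := aeval_ne_zero_of_notMem_range (moebius_chart_notMem_range hφ c) f.denom_ne_zero
  have hz0 : (z₂ : HahnSeries ℚ K) ≠ 0 := by
    intro h0; rw [hz₂, h0, mul_zero] at hne; exact hne rfl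
  -- The common factor $s$ cancels, leaving a quotient of integral series whose residues do not both
  -- vanish.
  rw [ratEval, hz₁, hz₂, mul_div_mul_left _ _ hs, ← hr₂, PosDegree]
  refine ⟨fun h0 => orderTop_div_neg ?_ h0 hz0, fun h0 => ?_⟩
  · rcases homEval_num_ne_zero_or f c with h1 | h1
    · rwa [hr₁]
    · exact absurd (hr₂ ▸ h0) h1
  · by_contra h1
    exact absurd (orderTop_div_nonneg (x := z₁) h1) (not_le.2 h0)

theorem finite_isPoleUniv (f : RatFunc K) : {c | IsPoleUniv f c}.Finite := by
  refine (((f.denom.rootSet_finite K).image ((↑) : K → OnePoint K)).insert ∞).subset ?_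
  intro c hc
  induction c using OnePoint.rec with
  | infty => exact Set.mem_insert _ _
  | coe a =>
    refine Set.mem_insert_of_mem _ ⟨a, ?_, rfl⟩
    rw [mem_rootSet]
    exact ⟨f.denom_ne_zero, by rw [coe_aeval_eq_eval]; exact hc⟩

end Chart

/-! ### Branches through the points of the curve -/

section Branch

variable {K : Type*} [Field K]

theorem aevalAeval_eq_eval_map {L : Type*} [CommRing L] [Algebra K L] (u v : L) (p : K[X][Y]) :
    aevalAeval u v p = (p.map (aeval u : K[X] →ₐ[K] L).toRingHom).eval v := by
  have h : (aevalAeval u v : K[X][Y] →ₐ[K] L).toRingHom =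
      eval₂RingHom (aeval u : K[X] →ₐ[K] L).toRingHom v := by
    ext <;> simp
  rw [eval_map]
  exact RingHom.congr_fun h p

theorem splits_reverse {L : Type*} [Field L] {f : L[X]} (hf : f.Splits) : f.reverse.Splits := by
  induction hf using Submonoid.closure_induction with
  | mem x hx =>
    apply Splits.of_natDegree_le_one
    refine (reverse_natDegree_le x).trans ?_
    rcases hx with ⟨a, rfl⟩ | ⟨a, rfl⟩
    · rw [natDegree_C]; exact zero_le_one
    · rw [natDegree_X_add_C]
  | one => rw [← C_1, reverse_C]; exact Splits.C _
  | mul x y _ _ hx hy => rw [reverse_mul_of_domain]; exact hx.mul hy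

/-- If the leading coefficient of a polynomial with integral coefficients has residue zero, and some
coefficient has nonzero residue, one of the roots is not integral. -/
theorem exists_root_orderTop_neg {Q : (integers K)[X]} {n : ℕ}
    (hn : (Q.map (integers K).val.toRingHom).natDegree = n)
    (hs : (Q.map (integers K).val.toRingHom).Splits) (hres : Q.map (res K).toRingHom ≠ 0)
    (hlead : res K (Q.coeff n) = 0) :
    ∃ φ : HahnSeries ℚ K, φ.orderTop < 0 ∧ (Q.map (integers K).val.toRingHom).IsRoot φ := by
  set q := Q.map (integers K).val.toRingHom with hq
  have hqc : ∀ j, q.coeff j = (Q.coeff j : HahnSeries ℚ K) := fun j => by rw [hq, coeff_map]; rfl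
  have hq0 : q ≠ 0 := by
    intro h0
    apply hres
    ext j
    have : Q.coeff j = 0 := Subtype.ext (by rw [← hqc, h0]; rfl)
    rw [coeff_map, this, map_zero, coeff_zero]
  -- If all roots were integral, so would be the coefficients of the monic normalization. Every
  -- coefficient of `Q` would then be an integral multiple of the leading one and have residue zero.
  by_contra! hcon
  have hm := monic_mul_leadingCoeff_inv hq0
  have hl0 : q.leadingCoeff ≠ 0 := leadingCoeff_ne_zero.2 hq0
  have hlift := (hs.mul (Splits.C q.leadingCoeff⁻¹)).mem_lift_of_roots_mem_range hm
    (integers K).val.toRingHom (by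
      intro a ha
      rw [mem_roots hm.ne_zero, IsRoot.def, eval_mul, eval_C] at ha
      have ha' : q.IsRoot a := (mul_eq_zero.1 ha).resolve_right (inv_ne_zero hl0)
      refine ⟨⟨a, mem_integers.2 ?_⟩, rfl⟩
      by_contra h
      exact hcon a (not_le.1 h) ha')
  rw [lifts_iff_coeff_lifts] at hlift
  apply hres
  ext j
  obtain ⟨z, hz⟩ := hlift j
  rw [coeff_mul_C] at hz
  have e : Q.coeff j = z * Q.coeff n := by
    apply Subtype.ext
    have hz' : (z : HahnSeries ℚ K) = q.coeff j * q.leadingCoeff⁻¹ := hz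
    change (Q.coeff j : HahnSeries ℚ K) = z * (Q.coeff n : HahnSeries ℚ K)
    rw [hz', ← hqc, ← hqc, mul_assoc, leadingCoeff, hn, inv_mul_cancel₀, mul_one]
    rwa [leadingCoeff, hn] at hl0
  rw [coeff_map, e, map_mul, coeff_zero]
  change _ * res K (Q.coeff n) = 0
  rw [hlead, mul_zero]

/-- A root, near the point `c` of `ℙ¹`, of a polynomial with integral coefficients whose residue
vanishes at `c`. -/
theorem exists_root_near {Q : (integers K)[X]} {n : ℕ} (c : OnePoint K)
    (hn : (Q.map (integers K).val.toRingHom).natDegree = n)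
    (hs : (Q.map (integers K).val.toRingHom).Splits) (hres : Q.map (res K).toRingHom ≠ 0)
    (hc : homEval c n (Q.map (res K).toRingHom) = 0)
    (hroot : ∀ b : K, ¬ (Q.map (integers K).val.toRingHom).IsRoot (algebraMap K _ b)) :
    ∃ φ : HahnSeries ℚ K, φ.orderTop < 0 ∧
      (Q.map (integers K).val.toRingHom).IsRoot (moebius (chart c) φ) := by
  induction c using OnePoint.rec with
  | infty =>
    rw [homEval_infty, coeff_map] at hc
    obtain ⟨φ, hφ, h⟩ := exists_root_orderTop_neg hn hs hres hc
    exact ⟨φ, hφ, by rwa [moebius_chart_infty]⟩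
  | coe b =>
    have hQd : Q.natDegree = n := by
      rw [← hn, natDegree_map_eq_of_injective]
      exact Subtype.val_injective
    have hrd : (Q.map (res K).toRingHom).natDegree ≤ n := natDegree_map_le.trans hQd.le
    -- A root near $b$ is shifted near 0, then inverted by reversing the polynomial: the vanishing
    -- residue at $b$ becomes that of the leading coefficient. As $b$ is not a root, reversal keeps
    -- the degree $n$.
    set T := taylor (algebraMap K (integers K) b) Q with hT
    have hTd : T.natDegree = n := by rw [hT, natDegree_taylor, hQd]
    have hTv : T.map (integers K).val.toRingHom =
        taylor (algebraMap K _ b) (Q.map (integers K).val.toRingHom) := by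
      rw [hT, taylor_apply, taylor_apply, Polynomial.map_comp]
      simp
    have hTr : T.map (res K).toRingHom = taylor b (Q.map (res K).toRingHom) := by
      rw [hT, taylor_apply, taylor_apply, Polynomial.map_comp]
      simp
    have h0 : (T.map (integers K).val.toRingHom).coeff 0 ≠ 0 := by
      rw [hTv, taylor_coeff_zero]
      exact hroot b
    have hTvd : (T.map (integers K).val.toRingHom).natDegree = n := by
      rw [hTv, natDegree_taylor, hn]
    have hrev : (reflect n T).map (integers K).val.toRingHom =
        (T.map (integers K).val.toRingHom).reverse := by
      rw [reverse, hTvd, reflect_map]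
    obtain ⟨φ, hφ, h⟩ := exists_root_orderTop_neg (Q := reflect n T) (n := n)
      (by
        rw [hrev]
        refine le_antisymm ((reverse_natDegree_le _).trans hTvd.le) ?_
        apply le_natDegree_of_ne_zero
        rwa [reverse, hTvd, coeff_reflect, revAt_le le_rfl, Nat.sub_self])
      (by
        rw [hrev, hTv]
        exact splits_reverse (hs.taylor _))
      (by
        rw [← reflect_map, Ne, reflect_eq_zero_iff, hTr]
        intro h
        exact hres ((taylor_eq_zero _ _).1 h))
      (by
        rw [coeff_reflect, revAt_le le_rfl, Nat.sub_self]
        rw [homEval_coe b hrd] at hc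
        rw [← taylor_coeff_zero, ← hTr, coeff_map] at hc
        exact hc)
    have hφ0 : φ ≠ 0 := by rintro rfl; simp at hφ
    refine ⟨φ, hφ, ?_⟩
    let _ := invertibleOfNonzero hφ0
    let _ := invertibleOfNonzero (inv_ne_zero hφ0)
    have h2 : eval (φ⁻¹) (T.map (integers K).val.toRingHom) = 0 := by
      have h3 := eval₂_reverse_eq_zero_iff (RingHom.id _) φ⁻¹ (T.map (integers K).val.toRingHom)
      rw [invOf_eq_inv, inv_inv] at h3
      refine h3.1 ?_
      rw [← hrev]
      exact h
    rw [hTv, taylor_eval] at h2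
    rw [moebius_chart_coe b hφ0]
    exact h2

variable {p : K[X][Y]}

theorem mem_curve {s : OnePoint K × OnePoint K} :
    s ∈ curve p ↔ biHom p (coord₀ s.1) (coord₁ s.1) (coord₀ s.2) (coord₁ s.2) = 0 :=
  Iff.of_eq Set.mem_ofPred_eq

theorem natDegree_coeff_le_degX (p : K[X][Y]) (j : ℕ) : (p.coeff j).natDegree ≤ degX p := by
  by_cases hj : j ∈ p.support
  · exact Finset.le_sup (f := fun j => (p.coeff j).natDegree) hj
  · rw [notMem_support_iff.1 hj]; simp

theorem biHom_eq_homEval (s₁ s₂ : OnePoint K) {P : K[X]}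
    (hP : ∀ j, P.coeff j = homEval s₁ (degX p) (p.coeff j)) :
    biHom p (coord₀ s₁) (coord₁ s₁) (coord₀ s₂) (coord₁ s₂) = homEval s₂ p.natDegree P := by
  rw [biHom, homEval]
  refine Finset.sum_congr rfl fun j _ => ?_
  rw [hP, homEval, Finset.sum_mul]

/-- The curve contains no whole fibre over a point $c$: for finite $a$, $x-a$ would divide the
primitive polynomial $p$, and at $\infty$ some coefficient attains the degree in $x$. -/
theorem exists_homEval_coeff_ne_zero (hp : p.IsPrimitive) (c : OnePoint K) :
    ∃ j, homEval c (degX p) (p.coeff j) ≠ 0 := by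
  induction c using OnePoint.rec with
  | infty =>
    have hne : p.support.Nonempty := nonempty_support_iff.2 hp.ne_zero
    obtain ⟨j, hj, h⟩ := Finset.exists_mem_eq_sup p.support hne fun j => (p.coeff j).natDegree
    refine ⟨j, ?_⟩
    rw [homEval_infty, degX, h]
    exact leadingCoeff_ne_zero.2 (mem_support_iff.1 hj)
  | coe a =>
    by_contra! hcon
    have hd : C (X - C a) ∣ p := by
      rw [C_dvd_iff_dvd_coeff]
      intro j
      rw [dvd_iff_isRoot, IsRoot.def, ← homEval_coe a (natDegree_coeff_le_degX p j)]
      exact hcon j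
    exact not_isUnit_X_sub_C a (hp _ hd)

/-- A root $b$ would make $y-b$ a divisor of the irreducible $p$, so $p$ would be a constant
multiple of $y-b$; for constant $b$ this lies in $K[y]$. -/
theorem eval_C_ne_zero (hp : Irreducible p) (hpy : ∀ b : K[X], p ≠ b.map C) (b : K) :
    p.eval (C b) ≠ 0 := by
  intro h
  obtain ⟨q, hq⟩ := dvd_iff_isRoot.2 h
  have hu : IsUnit q := (hp.isUnit_or_isUnit hq).resolve_left (not_isUnit_X_sub_C _)
  obtain ⟨u, hu', rfl⟩ := isUnit_iff.1 hu
  obtain ⟨k, -, rfl⟩ := isUnit_iff.1 hu'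
  refine hpy ((X - C b) * C k) ?_
  rw [hq]
  simp

theorem moebius_chart_toPuiseux (c : OnePoint K) (N : ℕ+) (x : HahnSeries ℤ K) :
    moebius (chart c) (toPuiseux N x) = toPuiseux N (moebius (chart c) x) :=
  (map_moebius ({ toPuiseux N with
    commutes' := fun a => by
      change toPuiseux N (algebraMap K _ a) = _
      rw [algebraMap_hahnSeries, algebraMap_hahnSeries, toPuiseux_single, Int.cast_zero, zero_mul] }
    : HahnSeries ℤ K →ₐ[K] HahnSeries ℚ K) _ _).symm

theorem orderTop_serX : (serX : HahnSeries ℚ K).orderTop < 0 := by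
  rw [serX, HahnSeries.orderTop_single one_ne_zero]
  exact_mod_cast (by norm_num : (-1 : ℚ) < 0)

theorem isPuiseux_of_moebius_chart {c : OnePoint K} {φ : HahnSeries ℚ K} (hφ : φ ≠ 0) {N : ℕ+}
    {x : HahnSeries ℤ K} (hx : moebius (chart c) φ = toPuiseux N x) : IsPuiseux φ := by
  induction c using OnePoint.rec with
  | infty =>
    rw [moebius_chart_infty] at hx
    exact hx ▸ isPuiseux_toPuiseux N x
  | coe b =>
    rw [moebius_chart_coe b hφ, ← eq_sub_iff_add_eq] at hx
    have : φ = toPuiseux N (x - HahnSeries.single 0 b)⁻¹ := by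
      rw [map_inv₀, map_sub, toPuiseux_single, Int.cast_zero, zero_mul, ← algebraMap_hahnSeries,
        ← hx, inv_inv]
    exact this ▸ isPuiseux_toPuiseux N _

/-- Through every point of the curve there is a branch, parametrized by a Puiseux series. -/
theorem exists_branch [IsAlgClosed K] [CharZero K] (hp : Irreducible p) (hpx : ∀ a : K[X], p ≠ C a)
    (hpy : ∀ b : K[X], p ≠ b.map C) (t : curve p) :
    ∃ φ : HahnSeries ℚ K, IsPuiseux φ ∧ PosDegree φ ∧
      aevalAeval (moebius (chart t.1.1) serX) (moebius (chart t.1.2) φ) p = 0 := by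
  have hdeg : p.natDegree ≠ 0 := fun h => hpx _ (eq_C_of_natDegree_eq_zero h)
  have hprim : p.IsPrimitive := hp.isPrimitive hdeg
  set U : HahnSeries ℚ K := moebius (chart t.1.1) serX with hU
  have hUt : U ∉ (algebraMap K (HahnSeries ℚ K)).range :=
    moebius_chart_notMem_range orderTop_serX _
  have hinj : Function.Injective (aeval U : K[X] →ₐ[K] HahnSeries ℚ K) :=
    (injective_iff_map_eq_zero _).2 fun h h0 => by
      by_contra hne
      exact aeval_ne_zero_of_notMem_range hUt hne h0
  have heval : ∀ V, aevalAeval U V p = (p.map (aeval U : K[X] →ₐ[K] _).toRingHom).eval V :=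
    fun V => aevalAeval_eq_eval_map U V p
  -- After division by $s$, the coefficients of $p(U,Y)$ are integral, and their residues are the
  -- coefficients of the bi-homogenization restricted to the fibre over $t_1$.
  obtain ⟨s, hs, hz⟩ := exists_aeval_moebius_chart_eq orderTop_serX t.1.1 (degX p)
  choose z hz using fun j => hz (p.coeff j) (natDegree_coeff_le_degX p j)
  let Q : (integers K)[X] := ∑ j ∈ Finset.range (p.natDegree + 1), monomial j (z j)
  have hQc : ∀ j, s * (Q.coeff j : HahnSeries ℚ K) = aeval U (p.coeff j) ∧
      res K (Q.coeff j) = homEval t.1.1 (degX p) (p.coeff j) := by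
    intro j
    simp only [Q, finsetSum_coeff, coeff_monomial, Finset.sum_ite_eq', Finset.mem_range]
    split_ifs with h
    · exact ⟨(hz j).1.symm, (hz j).2⟩
    · rw [coeff_eq_zero_of_natDegree_lt (by omega : p.natDegree < j)]
      simp [homEval]
  have hqQ : p.map (aeval U : K[X] →ₐ[K] HahnSeries ℚ K).toRingHom =
      C s * Q.map (integers K).val.toRingHom := by
    ext1 j
    rw [coeff_map, coeff_C_mul, coeff_map]
    exact (hQc j).1.symm
  have hroots : ∀ V, (Q.map (integers K).val.toRingHom).IsRoot V ↔ aevalAeval U V p = 0 := by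
    intro V
    rw [heval, hqQ, eval_mul, eval_C, mul_eq_zero, or_iff_right hs, IsRoot.def]
  -- $U$ comes from a Laurent series, so Newton–Puiseux applies to $p(U,Y)$.
  have hUser : U = toPuiseux 1 (moebius (chart t.1.1) (HahnSeries.single (-1) 1)) := by
    rw [← moebius_chart_toPuiseux, toPuiseux_single, hU, serX]
    simp
  have hNP : p.map (aeval U : K[X] →ₐ[K] HahnSeries ℚ K).toRingHom = (p.map
      (aeval (moebius (chart t.1.1) (HahnSeries.single (-1) 1) : HahnSeries ℤ K)
        : K[X] →ₐ[K] HahnSeries ℤ K).toRingHom).map (toPuiseux 1) := by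
    rw [Polynomial.map_map]
    congr 1
    refine ringHom_ext (fun a => ?_) ?_
    · change aeval U (C a) = toPuiseux 1 (aeval _ (C a))
      rw [aeval_C, aeval_C, algebraMap_hahnSeries, algebraMap_hahnSeries, toPuiseux_single,
        Int.cast_zero, zero_mul]
    · change aeval U X = toPuiseux 1 (aeval _ X)
      rw [aeval_X, aeval_X, hUser]
  have hp0 : p.map (aeval U : K[X] →ₐ[K] HahnSeries ℚ K).toRingHom ≠ 0 :=
    (Polynomial.map_ne_zero_iff hinj).2 hp.ne_zero
  obtain ⟨hsplit, N, hN⟩ := exists_splits_map_toPuiseux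
    (p.map (aeval (moebius (chart t.1.1) (HahnSeries.single (-1) 1) : HahnSeries ℤ K)
      : K[X] →ₐ[K] HahnSeries ℤ K).toRingHom)
    (fun h0 => hp0 (by rw [hNP, h0, Polynomial.map_zero]))
  rw [← hNP] at hsplit hN
  have hCs : ∀ {f : (HahnSeries ℚ K)[X]}, (C s * f).Splits → f.Splits := fun {f} h => by
    have := h.C_mul s⁻¹
    rwa [← mul_assoc, ← C_mul, inv_mul_cancel₀ hs, C_1, one_mul] at this
  obtain ⟨φ, hφ, hφr⟩ := exists_root_near (Q := Q) (n := p.natDegree) t.1.2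
    (by rw [← natDegree_C_mul hs, ← hqQ, natDegree_map_eq_of_injective hinj])
    (hCs (hqQ ▸ hsplit))
    (by
      obtain ⟨j, hj⟩ := exists_homEval_coeff_ne_zero hprim t.1.1
      intro h0
      apply hj
      rw [← (hQc j).2]
      have := congrArg (fun f => coeff f j) h0
      simpa using this)
    (by
      rw [← biHom_eq_homEval t.1.1 t.1.2 (fun j => ?_)]
      · exact mem_curve.1 t.2
      · rw [coeff_map]; exact (hQc j).2)
    -- A constant root $b$ would give $p(U,b)=0$ with $U$ transcendental, hence $p(x,b)=0$.
    (by
      intro b hb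
      rw [hroots] at hb
      refine eval_C_ne_zero hp hpy b (hinj ?_)
      rw [map_zero, ← hb, heval, eval_map, ← aeval_C U b]
      exact (hom_eval₂ p (RingHom.id _) (aeval U : K[X] →ₐ[K] _).toRingHom (C b)))
  have hφ0 : φ ≠ 0 := by rintro rfl; simp at hφ
  refine ⟨φ, ?_, hφ, (hroots _).1 hφr⟩
  obtain ⟨x, hx⟩ := hN (moebius (chart t.1.2) φ) (by
    rw [IsRoot.def, ← heval]; exact (hroots _).1 hφr)
  exact isPuiseux_of_moebius_chart hφ0 hx

end Branch

/-! ### Evaluation of rational functions in two variables -/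

section Evaluation

variable {K : Type*} [Field K] {L : Type*} [Field L] [Algebra K L]

theorem ofPoly_mul (n d : K[X][Y]) : ofPoly (n * d) = ofPoly n * ofPoly d := map_mul _ _ _

theorem ofPoly_add (n d : K[X][Y]) : ofPoly (n + d) = ofPoly n + ofPoly d := map_add _ _ _

/-- The graph of the evaluation, through `e`, of the elements of `K(x, y)` that have a denominator
not annihilated by `e`. -/
def evalGraph (e : K[X][Y] →ₐ[K] L) : Subalgebra K (RatFunc₂ K × L) where
  carrier := {al | ∃ n d, e d ≠ 0 ∧ al.1 * ofPoly d = ofPoly n ∧ al.2 * e d = e n}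
  mul_mem' := by
    intro a b ha hb
    rw [Set.mem_ofPred_eq] at *
    obtain ⟨n, d, h1, h2, h3⟩ := ha
    obtain ⟨n', d', h1', h2', h3'⟩ := hb
    refine ⟨n * n', d * d', by rw [map_mul]; exact mul_ne_zero h1 h1', ?_, ?_⟩
    · rw [ofPoly_mul, ofPoly_mul, ← h2, ← h2', Prod.fst_mul]; ring
    · rw [map_mul, map_mul, ← h3, ← h3', Prod.snd_mul]; ring
  add_mem' := by
    intro a b ha hb
    rw [Set.mem_ofPred_eq] at *
    obtain ⟨n, d, h1, h2, h3⟩ := ha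
    obtain ⟨n', d', h1', h2', h3'⟩ := hb
    refine ⟨n * d' + n' * d, d * d', by rw [map_mul]; exact mul_ne_zero h1 h1', ?_, ?_⟩
    · rw [ofPoly_mul, ofPoly_add, ofPoly_mul, ofPoly_mul, ← h2, ← h2', Prod.fst_add]; ring
    · rw [map_mul, map_add, map_mul, map_mul, ← h3, ← h3', Prod.snd_add]; ring
  algebraMap_mem' a := by
    rw [Set.mem_ofPred_eq]
    refine ⟨algebraMap K _ a, 1, by rw [map_one]; exact one_ne_zero, ?_, ?_⟩
    · rw [ofPoly, ofPoly, map_one, mul_one, ← IsScalarTower.algebraMap_apply]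
      rfl
    · rw [map_one, mul_one, AlgHom.commutes]
      rfl

variable {e : K[X][Y] →ₐ[K] L} {a b : RatFunc₂ K} {l m : L}

theorem mem_evalGraph : (a, l) ∈ evalGraph e ↔
    ∃ n d, e d ≠ 0 ∧ a * ofPoly d = ofPoly n ∧ l * e d = e n :=
  Iff.of_eq Set.mem_ofPred_eq

theorem ofPoly_mem_evalGraph (n : K[X][Y]) : (ofPoly n, e n) ∈ evalGraph e :=
  mem_evalGraph.2 ⟨n, 1, by rw [map_one]; exact one_ne_zero,
    by rw [ofPoly, ofPoly, map_one, mul_one], by rw [map_one, mul_one]⟩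

theorem div_mem_evalGraph (ha : (a, l) ∈ evalGraph e) (hb : (b, m) ∈ evalGraph e) (hm : m ≠ 0) :
    (a / b, l / m) ∈ evalGraph e := by
  rw [mem_evalGraph] at *
  obtain ⟨n, d, h1, h2, h3⟩ := ha
  obtain ⟨n', d', h1', h2', h3'⟩ := hb
  have hen : e n' ≠ 0 := h3' ▸ mul_ne_zero hm h1'
  have hn' : n' ≠ 0 := by rintro rfl; exact hen (map_zero e)
  have hb : b ≠ 0 := by
    rintro rfl
    rw [zero_mul, eq_comm, ofPoly, IsFractionRing.to_map_eq_zero_iff] at h2'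
    exact hn' h2'
  refine ⟨n * d', d * n', by rw [map_mul]; exact mul_ne_zero h1 hen, ?_, ?_⟩
  · rw [ofPoly_mul, ofPoly_mul, ← h2, ← h2']
    field_simp
  · rw [map_mul, map_mul, ← h3, ← h3']
    field_simp

/-- The reduced denominator divides the denominator of any other representation, so it is not
annihilated either. Hence `evalRat` can be computed from any admissible fraction. -/
theorem map_denom_ne_zero (h : (a, l) ∈ evalGraph e) :
    e (denom a) ≠ 0 ∧ e (numer a) = l * e (denom a) := by
  obtain ⟨n, d, h1, h2, h3⟩ := mem_evalGraph.1 h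
  have hden : ofPoly (denom a) ≠ 0 :=
    IsFractionRing.to_map_ne_zero_of_mem_nonZeroDivisors (IsFractionRing.den K[X][Y] a).2
  have h4 : a * ofPoly (denom a) = ofPoly (numer a) := by
    have := IsFractionRing.mk'_num_den' K[X][Y] a
    rw [div_eq_iff hden] at this
    exact this.symm
  have h5 : numer a * d = n * denom a := by
    apply IsFractionRing.injective K[X][Y] (RatFunc₂ K)
    change ofPoly _ = ofPoly _
    rw [ofPoly_mul, ofPoly_mul, ← h4, ← h2]
    ring
  have h6 : denom a ∣ d := by
    have hrel : IsRelPrime (denom a) (numer a) := (IsFractionRing.num_den_reduced K[X][Y] a).symm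
    exact hrel.dvd_of_dvd_mul_left ⟨n, by rw [h5, mul_comm]⟩
  obtain ⟨d', hd'⟩ := h6
  have h7 : e (denom a) ≠ 0 := fun h0 => h1 (by rw [hd', map_mul, h0, zero_mul])
  refine ⟨h7, mul_right_cancel₀ h1 ?_⟩
  rw [← map_mul, h5, map_mul, ← h3]
  ring

theorem evalRat_eq_of_mem {u v : L} (h : (a, l) ∈ evalGraph (aevalAeval u v)) :
    evalRat u v a = l := by
  obtain ⟨h1, h2⟩ := map_denom_ne_zero h
  rw [evalRat, h2, mul_div_cancel_right₀ _ h1]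

theorem evalRat_mem_evalGraph {u v : L} (h : aevalAeval u v (denom a) ≠ 0) :
    (a, evalRat u v a) ∈ evalGraph (aevalAeval u v) := by
  have := div_mem_evalGraph (ofPoly_mem_evalGraph (e := aevalAeval u v) (numer a))
    (ofPoly_mem_evalGraph (denom a)) h
  rwa [ofPoly, ofPoly, IsFractionRing.mk'_num_den'] at this

theorem aeval_mem_evalGraph (ha : (a, l) ∈ evalGraph e) (h : K[X]) :
    (aeval a h, aeval l h) ∈ evalGraph e := by
  have h1 := (aeval (⟨_, ha⟩ : evalGraph e) h).2
  have h2 := aeval_algHom_apply (evalGraph e).val (⟨_, ha⟩ : evalGraph e) h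
  have h3 := aeval_algHom_apply (AlgHom.fst K (RatFunc₂ K) L) (a, l) h
  have h4 := aeval_algHom_apply (AlgHom.snd K (RatFunc₂ K) L) (a, l) h
  have e2 : ((aeval (⟨_, ha⟩ : evalGraph e) h : evalGraph e) : RatFunc₂ K × L) =
      (aeval a h, aeval l h) := Prod.ext (by rw [← Subalgebra.coe_val, ← h2]; exact h3.symm)
        (by rw [← Subalgebra.coe_val, ← h2]; exact h4.symm)
  rwa [e2] at h1

theorem map_aevalAeval {A B : Type*} [CommRing A] [CommRing B] [Algebra K A] [Algebra K B]
    (ψ : A →ₐ[K] B) (x y : A) (p : K[X][Y]) :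
    ψ (aevalAeval x y p) = aevalAeval (ψ x) (ψ y) p := by
  have h : ψ.comp (aevalAeval x y) = aevalAeval (ψ x) (ψ y) := by
    refine algHom_ext' (by ext; simp) (by simp)
  exact DFunLike.congr_fun h p

theorem aevalAeval_mem_evalGraph (ha : (a, l) ∈ evalGraph e) (hb : (b, m) ∈ evalGraph e)
    (p : K[X][Y]) : (aevalAeval a b p, aevalAeval l m p) ∈ evalGraph e := by
  have h1 := (aevalAeval (⟨_, ha⟩ : evalGraph e) ⟨_, hb⟩ p).2
  have h2 := map_aevalAeval (evalGraph e).val ⟨_, ha⟩ ⟨_, hb⟩ p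
  have h3 := map_aevalAeval (AlgHom.fst K (RatFunc₂ K) L) (a, l) (b, m) p
  have h4 := map_aevalAeval (AlgHom.snd K (RatFunc₂ K) L) (a, l) (b, m) p
  have e2 : ((aevalAeval (⟨_, ha⟩ : evalGraph e) ⟨_, hb⟩ p : evalGraph e) : RatFunc₂ K × L) =
      (aevalAeval a b p, aevalAeval l m p) :=
    Prod.ext (by rw [← Subalgebra.coe_val, h2]; exact h3)
      (by rw [← Subalgebra.coe_val, h2]; exact h4)
  rwa [e2] at h1

theorem moebius_chart_mem_evalGraph (ha : (a, l) ∈ evalGraph e) (ha0 : a ≠ 0) (hl : l ≠ 0)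
    (c : OnePoint K) : (moebius (chart c) a, moebius (chart c) l) ∈ evalGraph e := by
  induction c using OnePoint.rec with
  | infty => rwa [moebius_chart_infty, moebius_chart_infty]
  | coe c =>
    rw [moebius_chart_coe c ha0, moebius_chart_coe c hl, ← one_div, ← one_div]
    exact add_mem (div_mem_evalGraph (one_mem _) ha hl) ((evalGraph e).algebraMap_mem c)

theorem ratEval_mem_evalGraph (ha : (a, l) ∈ evalGraph e) {f : RatFunc K}
    (hf : aeval l f.denom ≠ 0) : (ratEval a f, ratEval l f) ∈ evalGraph e :=
  div_mem_evalGraph (aeval_mem_evalGraph ha _) (aeval_mem_evalGraph ha _) hf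

theorem varX_mem_evalGraph (u v : L) : (varX, u) ∈ evalGraph (aevalAeval (R := K) u v) := by
  simpa using! ofPoly_mem_evalGraph (e := aevalAeval (R := K) u v) (C X)

theorem varY_mem_evalGraph (u v : L) : (varY, v) ∈ evalGraph (aevalAeval (R := K) u v) := by
  simpa using! ofPoly_mem_evalGraph (e := aevalAeval (R := K) u v) Y

theorem varX_ne_zero : (varX : RatFunc₂ K) ≠ 0 :=
  (IsFractionRing.to_map_eq_zero_iff).not.2 (C_ne_zero.2 X_ne_zero)

theorem varY_ne_zero : (varY : RatFunc₂ K) ≠ 0 :=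
  (IsFractionRing.to_map_eq_zero_iff).not.2 X_ne_zero

/-- Evaluating $r\circ T^{-1}$ at $(u,v)$ amounts to evaluating $r$ at the transformed point; this
connects the definition of a pole with values on a branch. -/
theorem evalRat_compT {u v : L} (hu : u ≠ 0) (hv : v ≠ 0) (c d : OnePoint K) (r : RatFunc₂ K)
    (hr : aevalAeval (moebius (chart c) u) (moebius (chart d) v) (denom r) ≠ 0) :
    (compT r (chart c) (chart d), evalRat (moebius (chart c) u) (moebius (chart d) v) r) ∈
      evalGraph (aevalAeval (R := K) u v) := by
  have h1 := moebius_chart_mem_evalGraph (varX_mem_evalGraph (K := K) u v) varX_ne_zero hu c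
  have h2 := moebius_chart_mem_evalGraph (varY_mem_evalGraph (K := K) u v) varY_ne_zero hv d
  exact div_mem_evalGraph (aevalAeval_mem_evalGraph h1 h2 _) (aevalAeval_mem_evalGraph h1 h2 _) hr

/-- At a generic point of an irreducible curve, only the multiples of its equation vanish. -/
theorem aevalAeval_ne_zero_of_not_dvd {p d : K[X][Y]} (hp : Irreducible p) (hdeg : p.natDegree ≠ 0)
    {u v : L} (hu : Function.Injective (aeval u : K[X] →ₐ[K] L)) (h0 : aevalAeval u v p = 0)
    (hd : ¬ p ∣ d) : aevalAeval u v d ≠ 0 := by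
  intro hd0
  let F := FractionRing K[X]
  let ι : F →+* L := IsFractionRing.lift (g := (aeval u : K[X] →ₐ[K] L).toRingHom) hu
  have hι : ∀ q : K[X][Y], eval₂ ι v (q.map (algebraMap K[X] F)) = aevalAeval u v q := by
    intro q
    rw [aevalAeval_eq_eval_map, eval_map, eval₂_map]
    refine congrArg (fun i => eval₂ i v q) (RingHom.ext fun x => ?_)
    exact IsFractionRing.lift_algebraMap hu x
  have hprim : p.IsPrimitive := hp.isPrimitive hdeg
  -- By Gauss's lemma $p$ stays irreducible over $K(x)$ and does not divide $d$ there; a Bézout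
  -- relation evaluated at $(u,v)$ would read $0=1$.
  have hirr : Irreducible (p.map (algebraMap K[X] F)) :=
    hprim.irreducible_iff_irreducible_map_fraction_map.1 hp
  have hnd : ¬ p.map (algebraMap K[X] F) ∣ d.map (algebraMap K[X] F) :=
    fun h => hd (hprim.dvd_of_fraction_map_dvd_fraction_map h)
  obtain ⟨α, β, hαβ⟩ := hirr.coprime_iff_not_dvd.2 hnd
  have := congrArg (eval₂ ι v) hαβ
  rw [eval₂_add, eval₂_mul, eval₂_mul, hι, hι, h0, hd0] at this
  simp at this

end Evaluation

/-! ### From branches to poles -/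

section Main

variable {K : Type*} [Field K]

theorem PosDegree.add {x y : HahnSeries ℚ K} (h : PosDegree (x + y)) :
    PosDegree x ∨ PosDegree y := by
  by_contra! hcon
  simp only [PosDegree, not_lt] at hcon
  exact absurd ((le_min hcon.1 hcon.2).trans HahnSeries.min_orderTop_le_orderTop_add) (not_le.2 h)

theorem PosDegree.neg {x : HahnSeries ℚ K} (h : PosDegree (-x)) : PosDegree x := by
  rwa [PosDegree, HahnSeries.orderTop_neg] at h

variable {p : K[X][Y]} {r : RatFunc₂ K}

/-- On a branch of the curve of `p`, the relation `f - g ∈ r + ⟨p⟩` becomes an equation. -/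
theorem ratEval_sub_ratEval (hp : Irreducible p) (hdeg : p.natDegree ≠ 0) (hr : r ∈ localRing p)
    {f g : RatFunc K} (hfg : (f, g) ∈ sepSet r p) {L : Type*} [Field L] [Algebra K L] {u v : L}
    (hu : Function.Injective (aeval u : K[X] →ₐ[K] L))
    (hv : Function.Injective (aeval v : K[X] →ₐ[K] L)) (h0 : aevalAeval u v p = 0) :
    ratEval u f - ratEval v g = evalRat u v r := by
  have hne : ∀ q ∈ localRing p, aevalAeval u v (denom q) ≠ 0 := fun q hq => by
    rw [localRing, Set.mem_ofPred_eq] at hq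
    exact aevalAeval_ne_zero_of_not_dvd hp hdeg hu h0 hq
  rw [sepSet, Set.mem_ofPred_eq] at hfg
  obtain ⟨s, hs, h⟩ := hfg
  rw [localIdeal, Set.mem_ofPred_eq] at hs
  obtain ⟨q, hq, rfl⟩ := hs
  have hfm := ratEval_mem_evalGraph (varX_mem_evalGraph (K := K) u v) (f := f)
    ((map_ne_zero_iff _ hu).2 f.denom_ne_zero)
  have hgm := ratEval_mem_evalGraph (varY_mem_evalGraph (K := K) u v) (f := g)
    ((map_ne_zero_iff _ hv).2 g.denom_ne_zero)
  have h1 := sub_mem hfm hgm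
  have hpm := ofPoly_mem_evalGraph (e := aevalAeval (R := K) u v) p
  have h2 := add_mem (evalRat_mem_evalGraph (hne r hr))
    (mul_mem (evalRat_mem_evalGraph (hne q hq)) hpm)
  rw [h0] at h2
  -- Both sides evaluate the same element of $K(x,y)$, and the multiple of $p$ contributes 0.
  have e1 : evalRat u v (ratEval varX f - ratEval varY g) = ratEval u f - ratEval v g :=
    evalRat_eq_of_mem h1
  have e2 : evalRat u v (r + q * ofPoly p) = evalRat u v r + evalRat u v q * 0 :=
    evalRat_eq_of_mem h2
  rw [← h, mul_zero, add_zero] at e2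
  exact e1.symm.trans e2

variable [IsAlgClosed K]

theorem injective_aeval_moebius_chart {φ : HahnSeries ℚ K} (hφ : φ.orderTop < 0)
    (c : OnePoint K) :
    Function.Injective (aeval (moebius (chart c) φ) : K[X] →ₐ[K] HahnSeries ℚ K) :=
  (injective_iff_map_eq_zero _).2 fun h h0 => by
    by_contra hne
    exact aeval_ne_zero_of_notMem_range (moebius_chart_notMem_range hφ c) hne h0

/-- A branch at `t` along which `r` is infinitely large shows that `t` is a pole of `r`. -/
theorem isPole_of_branch (hp : Irreducible p) (hdeg : p.natDegree ≠ 0) (hr : r ∈ localRing p)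
    (t : curve p) {φ : HahnSeries ℚ K} (hφ : IsPuiseux φ) (hφd : PosDegree φ)
    (h0 : aevalAeval (moebius (chart t.1.1) serX) (moebius (chart t.1.2) φ) p = 0)
    (hd : PosDegree (evalRat (moebius (chart t.1.1) serX) (moebius (chart t.1.2) φ) r)) :
    IsPole p r t := by
  classical
  have hs0 : (serX : HahnSeries ℚ K) ≠ 0 := by
    intro h; have := orderTop_serX (K := K); simp [h] at this
  have hφ0 : φ ≠ 0 := by rintro rfl; simp [PosDegree] at hφd
  refine ⟨(chart t.1.1)⁻¹, (chart t.1.2)⁻¹, inv_smul_eq_iff.2 (chart_smul_infty _).symm,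
    inv_smul_eq_iff.2 (chart_smul_infty _).symm, φ, hφ, ?_, hφd, ?_⟩
  · rw [inv_inv, inv_inv]
    have hpm := ofPoly_mem_evalGraph
      (e := aevalAeval (R := K) (moebius (chart t.1.1) serX) (moebius (chart t.1.2) φ)) p
    have h1 := evalRat_compT hs0 hφ0 t.1.1 t.1.2 (ofPoly p) (map_denom_ne_zero hpm).1
    rw [evalRat_eq_of_mem hpm, h0] at h1
    rw [(map_denom_ne_zero h1).2, zero_mul]
  · rw [inv_inv, inv_inv]
    have hne := aevalAeval_ne_zero_of_not_dvd (d := denom r) hp hdeg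
      (injective_aeval_moebius_chart orderTop_serX t.1.1) h0
      (by rw [localRing, Set.mem_ofPred_eq] at hr; exact hr)
    rw [evalRat_eq_of_mem (evalRat_compT hs0 hφ0 t.1.1 t.1.2 r hne)]
    exact hd

end Main

end SepVar

end

theorem mainTheorem6 {K : Type*} [Field K] [IsAlgClosed K] [CharZero K]
    (p : K[X][Y]) (hp : Irreducible p) (hpx : ∀ a : K[X], p ≠ C a) (hpy : ∀ b : K[X], p ≠ b.map C)
    (r : SepVar.RatFunc₂ K) (hr : r ∈ SepVar.localRing p)
    (f g : RatFunc K) (hfg : (f, g) ∈ SepVar.sepSet r p)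
    (s : SepVar.curve p) (hs : SepVar.IsPole p r s) (horb : (SepVar.orbit p s).Infinite) :
    ∃ t ∈ SepVar.orbit p s, SepVar.IsPole p r t ∧
      (¬ SepVar.IsPoleUniv f t.1.1 ∨ ¬ SepVar.IsPoleUniv g t.1.2) := by
  by_contra! hcon
  have hdeg : p.natDegree ≠ 0 := fun h => hpx _ (eq_C_of_natDegree_eq_zero h)
  have hiff : ∀ t ∈ SepVar.orbit p s,
      (SepVar.IsPoleUniv f t.1.1 ↔ SepVar.IsPoleUniv g t.1.2) := by
    intro t ht
    obtain ⟨φ, hφ, hφd, h0⟩ := SepVar.exists_branch hp hpx hpy t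
    have heq := SepVar.ratEval_sub_ratEval hp hdeg hr hfg
      (SepVar.injective_aeval_moebius_chart SepVar.orderTop_serX t.1.1)
      (SepVar.injective_aeval_moebius_chart hφd t.1.2) h0
    have hpole := SepVar.isPole_of_branch hp hdeg hr t hφ hφd h0
    rw [← heq] at hpole
    rw [sub_eq_add_neg] at hpole
    have hf := SepVar.isPoleUniv_iff_posDegree SepVar.orderTop_serX t.1.1 f
    have hg := SepVar.isPoleUniv_iff_posDegree hφd t.1.2 g
    set a := SepVar.ratEval (SepVar.moebius (SepVar.chart t.1.1) (SepVar.serX (K := K))) f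
    set b := SepVar.ratEval (SepVar.moebius (SepVar.chart t.1.2) φ) g
    -- If $r$ is infinite along the branch, `hcon` makes both sides true; otherwise $a$ and $b$
    -- differ by a finite quantity.
    by_cases hab : SepVar.PosDegree (a + -b)
    · exact ⟨fun _ => (hcon t ht (hpole hab)).2, fun _ => (hcon t ht (hpole hab)).1⟩
    · rw [hf, hg]
      constructor
      · intro ha
        rw [← add_neg_cancel_right a (-b), neg_neg] at ha
        exact ha.add.resolve_left hab
      · intro hb
        have hb' : SepVar.PosDegree (-(a + -b) + a) := by
          rwa [neg_add_rev, neg_neg, neg_add_cancel_right]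
        exact hb'.add.resolve_left fun h => hab h.neg
  have hmem : ∀ t, t ∈ SepVar.orbit p s ↔
      Relation.EqvGen (fun a b : SepVar.curve p => a.1.1 = b.1.1 ∨ a.1.2 = b.1.2) s t :=
    fun t => Iff.of_eq Set.mem_ofPred_eq
  -- A shared first coordinate carries the pole of $f$ over directly; a shared second one carries it
  -- through $g$ by `hiff`, which needs both points to lie in the orbit.
  have hstep : ∀ t t' : SepVar.curve p,
      Relation.EqvGen (fun a b : SepVar.curve p => a.1.1 = b.1.1 ∨ a.1.2 = b.1.2) t t' →
      t ∈ SepVar.orbit p s → (SepVar.IsPoleUniv f t.1.1 ↔ SepVar.IsPoleUniv f t'.1.1) := by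
    intro t t' h
    induction h with
    | rel t t' h =>
      intro ht
      have ht' : t' ∈ SepVar.orbit p s :=
        (hmem _).2 (((hmem _).1 ht).trans _ _ _ (Relation.EqvGen.rel _ _ h))
      rcases h with h | h
      · rw [h]
      · rw [hiff t ht, hiff t' ht', h]
    | refl t => exact fun _ => Iff.rfl
    | symm t t' h ih =>
      intro ht
      exact (ih ((hmem _).2 (((hmem _).1 ht).trans _ _ _ h.symm))).symm
    | trans t t' t'' h h' ih ih' =>
      intro ht
      exact (ih ht).trans (ih' ((hmem _).2 (((hmem _).1 ht).trans _ _ _ h)))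
  have hss : s ∈ SepVar.orbit p s := (hmem s).2 (Relation.EqvGen.refl s)
  refine horb (((SepVar.finite_isPoleUniv f).prod (SepVar.finite_isPoleUniv g)).preimage
    (Subtype.val_injective.injOn) |>.subset fun t ht => ?_)
  have h1 := (hstep s t ((hmem t).1 ht) hss).1 (hcon s hss hs).1
  exact ⟨h1, (hiff t ht).1 h1⟩
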